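/- **Setting.** Consider stiff systems $\dot x^{I}=f^{I}(t,x)$, $\epsilon\,\dot x^{II}=f^{II}(t,x)$ with $x=(x^I,x^{II})\in\mathbb R^{n_1}\times\mathbb R^{n_2}$, $n_2\ge 1$, where $\epsilon$ runs through a set of nonsingular matrices that accumulates at $0$, with $\|\epsilon^{-1}\|_2\le\kappa/\|\epsilon\|_2$. Let $Q$ and $R=Q^{-1}$ be invertible linear maps between micro-states $x$ and macro-states $u_\epsilon=Qx$, and $\hat f_\epsilon(u,t)=Q f_\epsilon(t,Ru)$, where $f_\epsilon=(f^I,\epsilon^{-1}f^{II})$. For an admissible start $(t_0,u_0)$ let $x_\epsilon$ be the micro-solution on $[t_0,t_0+T]$ with $x_\epsilon(t_0)=Ru_0$, and let the effective force $\bar f$ along it be $$\bar f(t)=\lim_{\delta\to0}\lim_{\|\epsilon\|\to0}\frac1\delta\int_t^{t+\delta}\hat f_\epsilon(Qx_\epsilon(\tau),\tau)\,d\tau\qquad(t_0<t<t_0+T).$$ Let $r,k,p,S\ge1$. The following holds uniformly in $\epsilon$ and in the start: $f^I,f^{II}$ are $C^r$, with all derivatives up to order $r$ bounded by $M$ in a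 tube of radius $\delta_0$ around $x_\epsilon$; $\bar f$ is $C^p$, with all derivatives up to order $p$ bounded by $M$; and along $x_\epsilon$ $$\hat f_\epsilon=\bar f(t)+\|\epsilon\|^{-1}\Big(\sum_{i=1}^{J}g_i\big(t,\tfrac{t-t_0}{\|\epsilon\|}\big)+d\big(t,\tfrac{t-t_0}{\|\epsilon\|}\big)\Big)+\rho_\epsilon(t),\qquad \|\rho_\epsilon\|\le M\|\epsilon\|,$$ where the profiles $g_i,d$ (which may depend on $\epsilon$) are $C^k$ in the first variable, each $g_i(t,\cdot)$ is periodic with mean zero and with a period at most $M$ that does not depend on $t$, and the derivatives of order $\le k$ in the first variable are bounded by $M$ for $g_i(t,\sigma)$ and by $Me^{-\sigma/M}$ for $d(t,\sigma)$, $\sigma\ge0$. **Scheme.** The kernel $K\in C^k(\mathbb R)$ vanishes outside $[-1,1]$ and satisfies $\int K=1$, $\int K(t)t^j\,dt=0$ for $1\le j\le p$; $K_\eta(t)=\frac2\eta K(\frac{2t}\eta)$. At each macro-time $t_n=t_{\mathrm{init}}+nH$ the HMM scheme takes the macro-state $u_n$, reconstructs $Ru_n$, applies a one-step micro-solver of order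 $r$ with step $h$ on $[t_n,t_n+\eta]$, $\eta=Nh$ with an integer $N\ge1$ (between grid points the computed micro-state is given by a shorter step and is continuous within each step), compresses the result by $Q$ to $u_\epsilon(\tau)$, and forms $F_n=(K_\eta'*u_\epsilon)(\Delta_n)$, $\Delta_n=t_n+\eta/2$. A macro-solver of order $S$ with step $H$ computes $u_{n+1}$ from finitely many of the last macro-states and macro-forces. Order $r$ of the micro-solver means: the local error of a step of length $s$ is $O((Ls)^{r+1})$ whenever the right-hand side and its derivatives up to order $r$ are bounded by $L\ge1$ near the solution and $Ls$ is small. The micro-solver is assumed numerically stable on the window: small perturbations, of total size at most $\delta_0$, committed in steps of length at most $h$ near the exact micro-solution produce an error of at most $\Lambda$ times their sum. Put $$\mathrm{Complexity}=\frac{\eta}{Hh},\qquad \mathrm{Speedup}=\frac H\eta,\qquad \mathcal E_n=\big\|F_n-\bar f(t_n+\eta)\big\|,\qquad \eta^*_q=\|\epsilon\|^{\frac{k-1}{k+q}}$$ (for $\eta\le\eta^*_q$ the term $\|\epsilon\|^{k-1}/\eta^k$ dominates $\eta^q$), where $\bar f$ belongs to the start $(t_n,u_n)$. **Theorem 1.**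 Fix $0<c_1\le1<c_2$ and $H_0>0$, and consider the scalings $$c_1\le \frac{\mathrm{Complexity}}{\|\epsilon\|^{-\frac{r+k+1}{kr}}H^{-\frac{r+k+1}{kr}S-1}}\le c_2,\qquad c_1\le\frac{\mathrm{Speedup}}{\|\epsilon\|^{\frac1k-1}H^{\frac Sk+1}}\le c_2.\qquad(*)$$ 1. For each $H>0$ and all sufficiently small $\|\epsilon\|>0$ there are $\eta,h>0$, with $\eta/h$ a positive integer, that satisfy $(*)$; if $k\ge2$, then moreover $\eta\le\eta^*_1$, $\eta\le\eta_p^*$ and $\|\epsilon\|\le H^S$. 2. There are $C_K,\varepsilon_0>0$, depending only on $n_1,n_2,r,k,p,S,J$, $K$, $Q$, $R$, the solvers, $\kappa,M,\delta_0,\Lambda,H_0,c_1,c_2$, such that for all such systems, all $\epsilon$ in the family with $\|\epsilon\|\le\varepsilon_0$, all $0<H\le H_0$, all $\eta<T$ and $h$ satisfying $(*)$, and every $n$ such that $(t_n,u_n)$ is an admissible start: if $\eta\le\eta^*_1$, then $$\mathcal E_n\le C_KH^S,$$ and if $\eta\le\eta^*_p$ and $\|\epsilon\|\le H^S$, then $\|F_n-\bar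 f(\Delta_n)\|\le C_KH^S$. -/

import Mathlib

open Set Filter Topology MeasureTheory Asymptotics

noncomputable section

/-! ### Stiff two-timescale systems -/

/-- The Euclidean space `ℝⁿ`. -/
abbrev Vec (n : ℕ) := EuclideanSpace ℝ (Fin n)

/-- Micro-states `x = (xᴵ, xᴵᴵ)`: slow part and fast part. -/
abbrev MicroState (n₁ n₂ : ℕ) := Vec n₁ × Vec n₂

/-- Nonsingular matrices `ε`, acting on the fast variables. -/
abbrev FastMat (n₂ : ℕ) := Vec n₂ ≃L[ℝ] Vec n₂

/-- The spectral norm `‖ε‖` (operator norm for the Euclidean norm). -/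
def matNorm {n₂ : ℕ} (ε : FastMat n₂) : ℝ := ‖(ε : Vec n₂ →L[ℝ] Vec n₂)‖

/-- The vector field of the stiff system `ẋᴵ = fᴵ(t, x)`, `ε ẋᴵᴵ = fᴵᴵ(t, x)`. -/
def stiffField {n₁ n₂ : ℕ} (fI : ℝ → MicroState n₁ n₂ → Vec n₁)
    (fII : ℝ → MicroState n₁ n₂ → Vec n₂) (ε : FastMat n₂) (t : ℝ) (x : MicroState n₁ n₂) :
    MicroState n₁ n₂ :=
  (fI t x, ε.symm (fII t x))

/-- `z` solves `ż = g(t, z)` on `[a, b]`. -/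
def SolvesOn {E : Type*} [NormedAddCommGroup E] [NormedSpace ℝ E] (g : ℝ → E → E)
    (z : ℝ → E) (a b : ℝ) : Prop :=
  ∀ t ∈ Icc a b, HasDerivWithinAt z (g t (z t)) (Icc a b) t

/-- The vector field `f̂_ε(u, t)` of `u_ε = Q x`, when `x = R u_ε` solves `ẋ = g(t, x)` and `Q`
is linear. -/
def transformedField {E U : Type*} [NormedAddCommGroup E] [NormedSpace ℝ E]
    [NormedAddCommGroup U] [NormedSpace ℝ U] (Q : E ≃L[ℝ] U) (R : U ≃L[ℝ] E) (g : ℝ → E → E)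
    (t : ℝ) (u : U) : U :=
  Q (g t (R u))

/-- `v = lim_{δ → 0+} lim_{‖ε‖ → 0, ε ∈ 𝓔} (1/δ) ∫_t^{t+δ} φ_ε(τ) dτ`. -/
def IsEffectiveForceAt {n₂ : ℕ} {U : Type*} [NormedAddCommGroup U] [NormedSpace ℝ U]
    (𝓔 : Set (FastMat n₂)) (φ : FastMat n₂ → ℝ → U) (t : ℝ) (v : U) : Prop :=
  ∃ inner : ℝ → U,
    (∀ᶠ δ in 𝓝[>] (0 : ℝ),
      Tendsto (fun ε => δ⁻¹ • ∫ τ in t..(t + δ), φ ε τ) (comap matNorm (𝓝 0) ⊓ 𝓟 𝓔)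
        (𝓝 (inner δ))) ∧
    Tendsto inner (𝓝[>] (0 : ℝ)) (𝓝 v)

/-- A profile `g(t, σ)` (slow time `t`, fast time `σ`) with `k` continuous derivatives
in slow time. -/
def SmoothProfile {U : Type*} [NormedAddCommGroup U] [NormedSpace ℝ U] (k : ℕ)
    (g : ℝ → ℝ → U) : Prop :=
  (∀ σ, ContDiff ℝ k (fun t => g t σ)) ∧
    ∀ j ≤ k, Continuous fun q : ℝ × ℝ => iteratedDeriv j (fun t => g t q.2) q.1

/-- Oscillatory fast dynamics: periodic in fast time with period at most `M`, with mean zero over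
a period, and with slow-time derivatives up to order `k` bounded by `M`. -/
structure IsOscillatory {U : Type*} [NormedAddCommGroup U] [NormedSpace ℝ U] (k : ℕ) (M : ℝ)
    (g : ℝ → ℝ → U) : Prop where
  smooth : SmoothProfile k g
  bound : ∀ j ≤ k, ∀ t σ, ‖iteratedDeriv j (fun t' => g t' σ) t‖ ≤ M
  periodic : ∃ P : ℝ, 0 < P ∧ P ≤ M ∧
    ∀ t, Function.Periodic (g t) P ∧ ∫ σ in (0 : ℝ)..P, g t σ = 0

/-- Dissipative fast dynamics: decaying exponentially in fast time, together with the slow-time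
derivatives up to order `k`. -/
structure IsDissipative {U : Type*} [NormedAddCommGroup U] [NormedSpace ℝ U] (k : ℕ) (M : ℝ)
    (g : ℝ → ℝ → U) : Prop where
  smooth : SmoothProfile k g
  bound : ∀ j ≤ k, ∀ t, ∀ σ, 0 ≤ σ →
    ‖iteratedDeriv j (fun t' => g t' σ) t‖ ≤ M * Real.exp (-σ / M)

/-- `w = v + (fast dynamics) + O(‖ε‖)` on `[t₀, t₀ + T]`, where the fast dynamics live on the time
scale `e = ‖ε‖`, have amplitude at most of the order `1/e` (the size of the stiff vector field),
and consist of `J` oscillatory components and a transient starting at `t₀`. -/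
def HasFastSlowSplitting {U : Type*} [NormedAddCommGroup U] [NormedSpace ℝ U] (k J : ℕ) (M e : ℝ)
    (t₀ T : ℝ) (w v : ℝ → U) : Prop :=
  ∃ (osc : Fin J → ℝ → ℝ → U) (diss : ℝ → ℝ → U),
    (∀ i, IsOscillatory k M (osc i)) ∧ IsDissipative k M diss ∧
    ∀ t ∈ Icc t₀ (t₀ + T),
      ‖w t - v t - e⁻¹ • (∑ i, osc i t ((t - t₀) / e) + diss t ((t - t₀) / e))‖ ≤ M * e

/-- A family of stiff two-timescale systems with an effective force.

* `𝓔` is the set of matrices `ε` under consideration, which accumulates at zero.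
* `D` is a set of admissible starting points `(t₀, u₀)`; `x ε t₀ u₀` is the exact micro-solution
  that starts from the reconstructed state `R u₀` at time `t₀`, on `[t₀, t₀ + T]`.
* `fbar t₀ u₀` is the effective force along these micro-solutions.

The numbers `κ`, `M`, `δ` are bounds that are uniform in `ε` and in the starting point. -/
structure IsTwoScaleFamily {n₁ n₂ nᵤ : ℕ} (r p k J : ℕ) (κ M δ T : ℝ)
    (Q : MicroState n₁ n₂ ≃L[ℝ] Vec nᵤ) (R : Vec nᵤ ≃L[ℝ] MicroState n₁ n₂)
    (fI : ℝ → MicroState n₁ n₂ → Vec n₁) (fII : ℝ → MicroState n₁ n₂ → Vec n₂)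
    (𝓔 : Set (FastMat n₂)) (D : Set (ℝ × Vec nᵤ))
    (x : FastMat n₂ → ℝ → Vec nᵤ → ℝ → MicroState n₁ n₂)
    (fbar : ℝ → Vec nᵤ → ℝ → Vec nᵤ) : Prop where
  accumulates : ∀ ρ : ℝ, 0 < ρ → ∃ ε ∈ 𝓔, matNorm ε < ρ
  /-- one fast time scale: the condition number of `ε` is bounded -/
  condition : ∀ ε ∈ 𝓔, matNorm ε.symm ≤ κ / matNorm ε
  smoothI : ContDiff ℝ r (Function.uncurry fI)
  smoothII : ContDiff ℝ r (Function.uncurry fII)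
  initial : ∀ ε ∈ 𝓔, ∀ t₀ u₀, (t₀, u₀) ∈ D → x ε t₀ u₀ t₀ = R u₀
  solves : ∀ ε ∈ 𝓔, ∀ t₀ u₀, (t₀, u₀) ∈ D →
    SolvesOn (stiffField fI fII ε) (x ε t₀ u₀) t₀ (t₀ + T)
  /-- the data of the system are bounded in a tube around the micro-solutions -/
  bounded : ∀ ε ∈ 𝓔, ∀ t₀ u₀, (t₀, u₀) ∈ D → ∀ t ∈ Icc t₀ (t₀ + T),
    ∀ y ∈ Metric.closedBall (x ε t₀ u₀ t) δ, ∀ j ≤ r,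
      ‖iteratedFDeriv ℝ j (Function.uncurry fI) (t, y)‖ ≤ M ∧
      ‖iteratedFDeriv ℝ j (Function.uncurry fII) (t, y)‖ ≤ M
  /-- `fbar` is the effective force of the transformed micro-dynamics -/
  effective : ∀ t₀ u₀, (t₀, u₀) ∈ D → ∀ t ∈ Ioo t₀ (t₀ + T),
    IsEffectiveForceAt 𝓔
      (fun ε τ => transformedField Q R (stiffField fI fII ε) τ (Q (x ε t₀ u₀ τ))) t
      (fbar t₀ u₀ t)
  smoothForce : ∀ t₀ u₀, (t₀, u₀) ∈ D → ContDiff ℝ p (fbar t₀ u₀)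
  boundedForce : ∀ t₀ u₀, (t₀, u₀) ∈ D → ∀ t ∈ Icc t₀ (t₀ + T), ∀ j ≤ p,
    ‖iteratedDeriv j (fbar t₀ u₀) t‖ ≤ M
  /-- the transformed force is the effective force plus fast dynamics -/
  splitting : ∀ ε ∈ 𝓔, ∀ t₀ u₀, (t₀, u₀) ∈ D →
    HasFastSlowSplitting k J M (matNorm ε) t₀ T
      (fun τ => transformedField Q R (stiffField fI fII ε) τ (Q (x ε t₀ u₀ τ))) (fbar t₀ u₀)

/-! ### Averaging kernels -/

/-- The class `𝕂^{p,k}([-1, 1])`: `k` times continuously differentiable kernels, vanishing outside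
`[-1, 1]`, with mass one and vanishing moments of the orders `1, …, p`. -/
structure IsKernel (p k : ℕ) (K : ℝ → ℝ) : Prop where
  smooth : ContDiff ℝ k K
  support : ∀ t, t ∉ Icc (-1 : ℝ) 1 → K t = 0
  mass : ∫ t, K t = 1
  moments : ∀ j : ℕ, 1 ≤ j → j ≤ p → ∫ t, K t * t ^ j = 0

/-- The rescaled kernel `K_η(t) = (2/η) K(2t/η)`, supported in `[-η/2, η/2]`. -/
def scaledKernel (K : ℝ → ℝ) (η t : ℝ) : ℝ := 2 / η * K (2 * t / η)

/-- The convolution `(K_η' * v)(Δ)` at the centre `Δ = t₀ + η/2` of the window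
`[t₀, t₀ + η]`. -/
def kernelForce {U : Type*} [NormedAddCommGroup U] [NormedSpace ℝ U] (K : ℝ → ℝ) (η t₀ : ℝ)
    (v : ℝ → U) : U :=
  ∫ τ in t₀..(t₀ + η), deriv (scaledKernel K η) (t₀ + η / 2 - τ) • v τ

/-! ### Solvers -/

/-- A micro-solver: `Φ g s t x` is the result of one step of length `s` for `ż = g(t, z)`, from the
state `x` at time `t`. -/
abbrev OneStep (E : Type*) := (ℝ → E → E) → ℝ → ℝ → E → E

/-- The one-step solver `Φ` has order `r`: if `g` and its derivatives up to order `r` are bounded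
by `L ≥ 1` around a solution, then the local error of a step of length `s` is
`O((L s)^(r+1))`. -/
def HasOrder {E : Type*} [NormedAddCommGroup E] [NormedSpace ℝ E] (Φ : OneStep E) (r : ℕ) : Prop :=
  ∀ δ : ℝ, 0 < δ → ∃ C > 0, ∃ ρ > 0, ∀ L : ℝ, 1 ≤ L → ∀ g : ℝ → E → E,
    ContDiff ℝ r (Function.uncurry g) → ∀ (t s : ℝ) (z : ℝ → E), 0 ≤ s → s * L ≤ ρ →
      SolvesOn g z t (t + s) →
      (∀ τ ∈ Icc t (t + s), ∀ y ∈ Metric.closedBall (z τ) δ, ∀ j ≤ r,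
        ‖iteratedFDeriv ℝ j (Function.uncurry g) (τ, y)‖ ≤ L) →
      ‖Φ g s t (z t) - z (t + s)‖ ≤ C * (s * L) ^ (r + 1)

/-- Numerical stability of the solver on `[t₀, t₀ + η]` near the solution `x`, for steps of length
at most `h`: small perturbations committed in the steps add up to an error that is at most `Λ`
times their sum. -/
def IsStableAlong {E : Type*} [NormedAddCommGroup E] [NormedSpace ℝ E] (Φ : OneStep E)
    (g : ℝ → E → E) (x : ℝ → E) (t₀ η h δ Λ : ℝ) : Prop :=
  ∀ (n : ℕ) (s : ℕ → ℝ) (v w : ℕ → E),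
    (∀ i < n, s i ∈ Icc 0 h) → ∑ i ∈ Finset.range n, s i ≤ η →
    v 0 = w 0 →
    (∀ i < n, v (i + 1) = Φ g (s i) (t₀ + ∑ j ∈ Finset.range i, s j) (v i)) →
    (∀ i ≤ n, ‖w i - x (t₀ + ∑ j ∈ Finset.range i, s j)‖ ≤ δ) →
    ∑ i ∈ Finset.range n,
      ‖w (i + 1) - Φ g (s i) (t₀ + ∑ j ∈ Finset.range i, s j) (w i)‖ ≤ δ →
    ‖v n - w n‖ ≤ Λ * ∑ i ∈ Finset.range n,
      ‖w (i + 1) - Φ g (s i) (t₀ + ∑ j ∈ Finset.range i, s j) (w i)‖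

/-- The micro-states at the grid points `t₀ + j h`. -/
def microGrid {E : Type*} (Φ : OneStep E) (g : ℝ → E → E) (h t₀ : ℝ) (x₀ : E) : ℕ → E
  | 0 => x₀
  | j + 1 => Φ g h (t₀ + j * h) (microGrid Φ g h t₀ x₀ j)

/-- The computed micro-state as a function of time: between two grid points it is the result of a
shorter step from the grid point on the left. -/
def microPath {E : Type*} (Φ : OneStep E) (g : ℝ → E → E) (h t₀ : ℝ) (x₀ : E) (τ : ℝ) : E :=
  Φ g (τ - (t₀ + ⌊(τ - t₀) / h⌋₊ * h)) (t₀ + ⌊(τ - t₀) / h⌋₊ * h)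
    (microGrid Φ g h t₀ x₀ ⌊(τ - t₀) / h⌋₊)

/-- A macro-solver that uses the present and `m` past macro-states and macro-forces:
`Ψ H t (u_n, u_{n-1}, …, u_{n-m}) (F_n, …, F_{n-m})` is the next macro-state. -/
abbrev MacroStep (U : Type*) (m : ℕ) := ℝ → ℝ → (Fin (m + 1) → U) → (Fin (m + 1) → U) → U

/-- The macro-solver has order `S`: its local truncation error is `O(H^(S+1))` on smooth
functions. -/
def HasMacroOrder {U : Type*} [NormedAddCommGroup U] [NormedSpace ℝ U] {m : ℕ}
    (Ψ : MacroStep U m) (S : ℕ) : Prop :=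
  ∀ u : ℝ → U, ContDiff ℝ (S + 1) u → ∀ t : ℝ,
    (fun H : ℝ => u (t + H) -
      Ψ H t (fun j => u (t - (j : ℕ) * H)) (fun j => deriv u (t - (j : ℕ) * H)))
      =O[𝓝[>] (0 : ℝ)] fun H => H ^ (S + 1)

/-! ### The HMM scheme -/

/-- The macro-force estimated in the window `[t, t + η]` from the macro-state `u`: reconstruct
`R u`, run the micro-solver with step `h`, compress by `Q`, and average with `K_η'`. -/
def macroForce {E U : Type*} [NormedAddCommGroup E] [NormedSpace ℝ E]
    [NormedAddCommGroup U] [NormedSpace ℝ U] (Q : E ≃L[ℝ] U) (R : U ≃L[ℝ] E) (K : ℝ → ℝ)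
    (Φ : OneStep E) (g : ℝ → E → E) (η h t : ℝ) (u : U) : U :=
  kernelForce K η t fun τ => Q (microPath Φ g h t (R u) τ)

/-- A run of the HMM scheme from time `tInit`: macro-states `u n` and estimated macro-forces `F n`
at the macro-times `tInit + n H`. The first `m + 1` macro-states are starting values. -/
structure IsHMMRun {E U : Type*} [NormedAddCommGroup E] [NormedSpace ℝ E]
    [NormedAddCommGroup U] [NormedSpace ℝ U] {m : ℕ} (Q : E ≃L[ℝ] U) (R : U ≃L[ℝ] E) (K : ℝ → ℝ)
    (Φ : OneStep E) (Ψ : MacroStep U m) (g : ℝ → E → E) (H η h tInit : ℝ)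
    (u F : ℕ → U) : Prop where
  microProcess : ∀ n, F n = macroForce Q R K Φ g η h (tInit + n * H) (u n)
  macroProcess : ∀ n, m ≤ n →
    u (n + 1) = Ψ H (tInit + n * H) (fun j => u (n - (j : ℕ))) (fun j => F (n - (j : ℕ)))

/-- The computational complexity `η / (H h)`: each macro-step, of length `H`, costs `η / h`
micro-steps, so this is the number of micro-steps per unit of simulated time. -/
def complexity (H η h : ℝ) : ℝ := η / (H * h)

/-- The speedup `H / η`: a simulation with the micro-solver alone takes `H / h` micro-steps per
macro-step instead of `η / h`. -/
def speedup (H η : ℝ) : ℝ := H / η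

/-- The rate `e^{-(r+k+1)/(kr)} H^{-(r+k+1)S/(kr) - 1}`. -/
def complexityRate (r k S : ℕ) (e H : ℝ) : ℝ :=
  e ^ (-(((r : ℝ) + k + 1) / (k * r))) * H ^ (-(((r : ℝ) + k + 1) / (k * r)) * S - 1)

/-- The rate `e^{1/k - 1} H^{S/k + 1}`. -/
def speedupRate (k S : ℕ) (e H : ℝ) : ℝ :=
  e ^ (1 / (k : ℝ) - 1) * H ^ ((S : ℝ) / k + 1)

/-- Complexity and speedup are of the exact order of their rates, with the constants
`c₁` and `c₂`. -/
def SatisfiesScaling (r k S : ℕ) (c₁ c₂ e H η h : ℝ) : Prop :=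
  complexity H η h ∈ Icc (c₁ * complexityRate r k S e H) (c₂ * complexityRate r k S e H) ∧
    speedup H η ∈ Icc (c₁ * speedupRate k S e H) (c₂ * speedupRate k S e H)

/-- The threshold `η* = e^{(k-1)/(k+q)}`: for `0 < η`, one has `η ≤ η*` if and only if
`η^q ≤ e^{k-1} / η^k`. -/
def windowThreshold (q k : ℕ) (e : ℝ) : ℝ := e ^ (((k : ℝ) - 1) / (k + q))

end

/-!
The averaging `K_η' * u_ε` at the centre `Δ` of a window of length `η` is compared with the same
averaging of the exact micro-solution. Throughout, `e` stands for `‖ε‖`.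

*Exact micro-solution.* Integration by parts (`IsKernel.kernelForce_eq`) turns `K_η' * Q x` into
`K_η * (Q x)'`, and the velocity `(Q x)'` splits into the effective force, fast dynamics and a
remainder of size `O(e)`.
The vanishing moments of the kernel reproduce Taylor polynomials, so the effective force contributes
`O(η^p)` (`IsKernel.norm_average_sub_le`). The fast dynamics contribute `O(e^(k-1) / η^k)`:

* For an oscillatory component, `I(b) = ∫ a(τ) g(τ, τ/e + b) dτ` is a periodic function of the phase
  `b` with mean zero, hence bounded by its period times the bound of its derivative. The substitution
  `τ ↦ τ - e b` shows that `I'(b)` is `-e` times an integral of the same kind, with one slow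
  derivative on `a` or on `g`. After `k` rounds this gives `e^k`, while each derivative of the
  kernel costs `1/η` (`norm_integral_oscillation_le`).
* The transient lives within `O(e)` of the beginning of the window, where the kernel vanishes to order
  `k - 1` (`IsKernel.norm_average_dissipative_le`).

*Computed micro-solution.* All derivatives of the stiff field are `O(1/e)`, so a micro-step has local
error `O((h/e)^(r+1))`. By stability the errors add up to `O(η h^r / e^(r+1))` on the window
(`norm_microPath_sub_le`), and averaging against `K_η'` costs a factor `1/η`.

*Scalings.* With `q = e H^S`, the prescribed speedup says that `e/η` is of the order `q^(1/k)`, and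
the prescribed complexity then gives `h/e = O(q^((k+1)/(kr)))`. Hence `e^(k-1) / η^k = O(H^S)` and
`h^r / e^(r+1) = O(H^S q^(1/k))`, while `η ≤ η*_q` bounds `η^q` by `e^(k-1) / η^k`. At the end point
of the window instead of its centre one loses `O(η)`, and then the remainder `O(e)` is itself `O(η)`.
-/

/-! ### Taylor estimates -/

/-- Taylor's theorem about an arbitrary point `c` of an interval, with a two-sided remainder
bound. -/
theorem norm_sub_taylor_le {U : Type*} [NormedAddCommGroup U] [NormedSpace ℝ U] {a b M : ℝ} (p : ℕ) :
    ∀ {f : ℝ → U}, ContDiff ℝ p f → (∀ t ∈ Icc a b, ‖iteratedDeriv p f t‖ ≤ M) →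
    ∀ c ∈ Icc a b, ∀ t ∈ Icc a b,
      ‖f t - ∑ j ∈ Finset.range p, ((t - c) ^ j / (j.factorial : ℝ)) • iteratedDeriv j f c‖
        ≤ M * |t - c| ^ p := by
  induction p with
  | zero => intro f _ hM c _ t ht; simpa using hM t ht
  | succ p ih =>
    intro f hf hM c hc t ht
    have hf1 : ContDiff ℝ ((p : WithTop ℕ∞) + 1) f := by exact_mod_cast hf
    have hf' : ContDiff ℝ p (deriv f) := (contDiff_succ_iff_deriv.1 hf1).2.2
    have hfd : Differentiable ℝ f := (contDiff_succ_iff_deriv.1 hf1).1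
    have hM0 : 0 ≤ M := (norm_nonneg _).trans (hM c hc)
    have key := ih hf' (fun s hs => by rw [← iteratedDeriv_succ']; exact hM s hs) c hc
    have hsub : uIcc c t ⊆ Icc a b := uIcc_subset_Icc hc ht
    have hder : ∀ s ∈ uIcc c t, HasDerivWithinAt
        (fun s => f s - ∑ j ∈ Finset.range (p + 1),
          ((s - c) ^ j / (j.factorial : ℝ)) • iteratedDeriv j f c)
        (deriv f s - ∑ j ∈ Finset.range p,
          ((s - c) ^ j / (j.factorial : ℝ)) • iteratedDeriv j (deriv f) c) (uIcc c t) s := by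
      intro s _
      refine HasDerivAt.hasDerivWithinAt (HasDerivAt.sub (hfd s).hasDerivAt ?_)
      have : (∑ j ∈ Finset.range p, ((s - c) ^ j / (j.factorial : ℝ)) • iteratedDeriv j (deriv f) c)
          = ∑ j ∈ Finset.range (p + 1),
            ((j : ℝ) * (s - c) ^ (j - 1) / (j.factorial : ℝ)) • iteratedDeriv j f c := by
        rw [Finset.sum_range_succ']
        simp only [Nat.cast_zero, zero_mul, zero_div, zero_smul, add_zero]
        refine Finset.sum_congr rfl fun j _ => ?_
        rw [iteratedDeriv_succ', Nat.factorial_succ, Nat.add_sub_cancel]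
        congr 1
        push_cast
        have : (j.factorial : ℝ) ≠ 0 := by exact_mod_cast j.factorial_ne_zero
        field_simp
      rw [this]
      refine HasDerivAt.fun_sum fun j _ => ?_
      have h1 : HasDerivAt (fun s : ℝ => (s - c) ^ j) ((j : ℝ) * (s - c) ^ (j - 1)) s := by
        simpa using ((hasDerivAt_id s).sub_const c).fun_pow j
      exact (h1.div_const _).smul_const _
    have hb : ∀ s ∈ uIcc c t, ‖deriv f s - ∑ j ∈ Finset.range p,
          ((s - c) ^ j / (j.factorial : ℝ)) • iteratedDeriv j (deriv f) c‖ ≤ M * |t - c| ^ p := by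
      intro s hs
      refine (key s (hsub hs)).trans ?_
      gcongr M * ?_ ^ p
      rcases le_total c t with h | h
      · rw [uIcc_of_le h] at hs
        rw [abs_of_nonneg (by linarith [hs.1]), abs_of_nonneg (by linarith)]; linarith [hs.2]
      · rw [uIcc_of_ge h] at hs
        rw [abs_of_nonpos (by linarith [hs.2]), abs_of_nonpos (by linarith)]; linarith [hs.1]
    have := Convex.norm_image_sub_le_of_norm_hasDerivWithin_le hder hb (convex_uIcc c t)
      left_mem_uIcc right_mem_uIcc
    have h0 : f c - ∑ j ∈ Finset.range (p + 1),
        ((c - c) ^ j / (j.factorial : ℝ)) • iteratedDeriv j f c = 0 := by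
      rw [Finset.sum_range_succ']; simp
    rw [h0, sub_zero] at this
    rw [pow_succ, ← mul_assoc]
    simpa using this

/-! ### Cancellation of oscillations -/

theorem hasDerivAt_intervalIntegral_of_continuous {U : Type*} [NormedAddCommGroup U]
    [NormedSpace ℝ U] {F F' : ℝ → ℝ → U} (hF : Continuous (Function.uncurry F))
    (hF' : Continuous (Function.uncurry F'))
    (h : ∀ x t, HasDerivAt (fun x => F x t) (F' x t) x) (a b x₀ : ℝ) :
    HasDerivAt (fun x => ∫ t in a..b, F x t) (∫ t in a..b, F' x₀ t) x₀ := by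
  obtain ⟨C, hC⟩ := ((isCompact_closedBall x₀ (1 : ℝ)).prod
    (isCompact_uIcc (a := a) (b := b))).exists_bound_of_continuousOn hF'.continuousOn
  have hs : ∀ x, Continuous (F x) := fun x => hF.comp (by fun_prop : Continuous fun t => (x, t))
  have hs' : ∀ x, Continuous (F' x) := fun x => hF'.comp (by fun_prop : Continuous fun t => (x, t))
  refine (intervalIntegral.hasDerivAt_integral_of_dominated_loc_of_deriv_le
    (bound := fun _ => C) (Metric.closedBall_mem_nhds x₀ one_pos)
    (Eventually.of_forall fun x => (hs x).aestronglyMeasurable)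
    ((hs x₀).intervalIntegrable _ _) (hs' x₀).aestronglyMeasurable
    (Eventually.of_forall fun t ht x hx => hC (x, t) ⟨hx, uIoc_subset_uIcc ht⟩)
    intervalIntegrable_const (Eventually.of_forall fun t _ x _ => h x t)).2

/-- A periodic function with mean zero is bounded by the period times its Lipschitz constant. -/
theorem norm_le_of_periodic_of_mean_zero {U : Type*} [NormedAddCommGroup U] [NormedSpace ℝ U]
    [CompleteSpace U] {f f' : ℝ → U} {P C : ℝ} (hP : 0 < P) (hf : ∀ b, HasDerivAt f (f' b) b)
    (hC : ∀ b, ‖f' b‖ ≤ C) (hper : Function.Periodic f P) (hmean : ∫ b in (0 : ℝ)..P, f b = 0)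
    (b : ℝ) : ‖f b‖ ≤ P * C := by
  have hcont : Continuous f := continuous_iff_continuousAt.2 fun b => (hf b).continuousAt
  have h0 : ∫ s in b..(b + P), f s = 0 := by
    rw [hper.intervalIntegral_add_eq b 0, zero_add, hmean]
  have h1 : ∫ s in b..(b + P), (f b - f s) = P • f b := by
    rw [intervalIntegral.integral_sub intervalIntegrable_const (hcont.intervalIntegrable _ _), h0]
    simp
  have hC0 : 0 ≤ C := (norm_nonneg _).trans (hC 0)
  have h2 : ‖∫ s in b..(b + P), (f b - f s)‖ ≤ (C * P) * |b + P - b| := by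
    refine intervalIntegral.norm_integral_le_of_norm_le_const fun s hs => ?_
    rw [uIoc_of_le (by linarith)] at hs
    refine (Convex.norm_image_sub_le_of_norm_hasDerivWithin_le (s := univ)
      (fun x _ => (hf x).hasDerivWithinAt) (fun x _ => hC x) convex_univ
      (mem_univ s) (mem_univ b)).trans ?_
    gcongr
    rw [Real.norm_eq_abs, abs_of_nonpos (by linarith [hs.1])]; linarith [hs.2]
  rw [h1, norm_smul, Real.norm_of_nonneg hP.le, add_sub_cancel_left, abs_of_pos hP] at h2
  have := le_of_mul_le_mul_left (h2.trans_eq (by ring : C * P * P = P * (P * C))) hP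
  exact this

/-- Differentiating `∫ a(τ) g(τ, τ/e + b) dτ` in the phase `b`: after the substitution
`τ ↦ τ - e b` the phase sits in the slow variable only, which gains a factor `e`. -/
theorem hasDerivAt_integral_phase {U : Type*} [NormedAddCommGroup U] [NormedSpace ℝ U]
    {a a' : ℝ → ℝ} {g g' : ℝ → ℝ → U} {α β e : ℝ} (he : 0 < e)
    (hac : Continuous a) (hac' : Continuous a') (ha : ∀ t, HasDerivAt a (a' t) t)
    (ha0 : ∀ t ∉ Ioo α β, a t = 0) (ha0' : ∀ t ∉ Ioo α β, a' t = 0)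
    (hgc : Continuous (Function.uncurry g)) (hgc' : Continuous (Function.uncurry g'))
    (hg : ∀ σ t, HasDerivAt (fun t => g t σ) (g' t σ) t) (b₀ : ℝ) :
    HasDerivAt (fun b => ∫ τ in α..β, a τ • g τ (τ / e + b))
      (-(e • ((∫ τ in α..β, a' τ • g τ (τ / e + b₀)) +
        ∫ τ in α..β, a τ • g' τ (τ / e + b₀)))) b₀ := by
  have hcomp : ∀ (c : ℝ → ℝ) (f : ℝ → ℝ → U), Continuous c → Continuous (Function.uncurry f) →
      Continuous fun q : ℝ × ℝ => c (q.2 - e * q.1) • f (q.2 - e * q.1) (q.2 / e) := by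
    intro c f hc hf
    exact (hc.comp (by fun_prop)).smul
      (hf.comp (by fun_prop : Continuous fun q : ℝ × ℝ => (q.2 - e * q.1, q.2 / e)))
  -- near `b₀`, all shifted windows lie in one fixed interval
  have hshift : ∀ (c : ℝ → ℝ) (f : ℝ → ℝ → U), (∀ t ∉ Ioo α β, c t = 0) →
      ∀ b ∈ Metric.ball b₀ 1, ∫ τ in α..β, c τ • f τ (τ / e + b) =
        ∫ τ in (α + e * (b₀ - 1))..(β + e * (b₀ + 1)),
          c (τ - e * b) • f (τ - e * b) (τ / e) := by
    intro c f hc b hb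
    rw [Metric.mem_ball, Real.dist_eq, abs_lt] at hb
    rw [intervalIntegral.integral_eq_integral_of_support_subset,
      intervalIntegral.integral_eq_integral_of_support_subset,
      ← integral_sub_right_eq_self (fun τ => c τ • f τ (τ / e + b)) (e * b)]
    · congr 1; ext τ
      congr 2
      field_simp; ring
    · intro τ hτ
      have h1 : τ - e * b ∈ Ioo α β := by
        by_contra h; exact hτ (by simp [hc _ h])
      have h2 : e * (b₀ - 1) ≤ e * b := by gcongr; linarith
      have h3 : e * b ≤ e * (b₀ + 1) := by gcongr; linarith
      exact ⟨by linarith [h1.1], by linarith [h1.2]⟩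
    · intro τ hτ
      have h1 : τ ∈ Ioo α β := by
        by_contra h; exact hτ (by simp [hc _ h])
      exact ⟨h1.1, h1.2.le⟩
  have hb₀ : b₀ ∈ Metric.ball b₀ (1 : ℝ) := Metric.mem_ball_self one_pos
  have hder := hasDerivAt_intervalIntegral_of_continuous
    (F := fun b τ => a (τ - e * b) • g (τ - e * b) (τ / e))
    (F' := fun b τ => -(e • (a' (τ - e * b) • g (τ - e * b) (τ / e) +
      a (τ - e * b) • g' (τ - e * b) (τ / e))))
    (hcomp a g hac hgc)
    ((((hcomp a' g hac' hgc).add (hcomp a g' hac hgc')).const_smul e).neg)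
    (fun b τ => by
      have hl : HasDerivAt (fun b => τ - e * b) (-e) b := by
        simpa using ((hasDerivAt_id b).const_mul e).const_sub τ
      have h1 := HasDerivAt.scomp b (ha (τ - e * b)) hl
      have h2 := HasDerivAt.scomp b (hg (τ / e) (τ - e * b)) hl
      have := h1.smul h2
      refine this.congr_deriv ?_
      simp only [Function.comp, smul_eq_mul]
      module) (α + e * (b₀ - 1)) (β + e * (b₀ + 1)) b₀
  refine (hder.congr_of_eventuallyEq ?_).congr_deriv ?_
  · filter_upwards [Metric.ball_mem_nhds b₀ one_pos] with b hb
    exact hshift a g ha0 b hb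
  · have hint : ∀ (c : ℝ → ℝ) (f : ℝ → ℝ → U), Continuous c → Continuous (Function.uncurry f) →
        ∀ A B, IntervalIntegrable (fun τ => c (τ - e * b₀) • f (τ - e * b₀) (τ / e)) volume A B :=
      fun c f hc hf A B => ((hcomp c f hc hf).comp
        (by fun_prop : Continuous fun τ : ℝ => (b₀, τ))).intervalIntegrable _ _
    rw [hshift a' g ha0' b₀ hb₀, hshift a g' ha0 b₀ hb₀, intervalIntegral.integral_neg,
      intervalIntegral.integral_smul, intervalIntegral.integral_add (hint _ _ hac' hgc _ _)
        (hint _ _ hac hgc' _ _)]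

/-- Repeated gain of a factor `e`. The sequences `a` and `g` stand for the successive derivatives of
the window function and of the profile; each differentiation in the phase `b` moves one derivative
onto one of the two factors. -/
theorem norm_integral_oscillation_le {U : Type*} [NormedAddCommGroup U] [NormedSpace ℝ U]
    [CompleteSpace U] {k : ℕ} {a : ℕ → ℝ → ℝ} {g : ℕ → ℝ → ℝ → U} {α β e P A G : ℝ}
    (hαβ : α ≤ β) (he : 0 < e) (hP : 0 < P)
    (hac : ∀ i ≤ k, Continuous (a i)) (ha : ∀ i < k, ∀ t, HasDerivAt (a i) (a (i + 1) t) t)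
    (ha0 : ∀ i ≤ k, ∀ t ∉ Ioo α β, a i t = 0) (haA : ∀ i ≤ k, ∀ t, |a i t| ≤ A)
    (hgc : ∀ l ≤ k, Continuous (Function.uncurry (g l)))
    (hg : ∀ l < k, ∀ σ t, HasDerivAt (fun t => g l t σ) (g (l + 1) t σ) t)
    (hgG : ∀ l ≤ k, ∀ t σ, ‖g l t σ‖ ≤ G)
    (hper : ∀ l ≤ k, ∀ t, Function.Periodic (g l t) P)
    (hmean : ∀ l ≤ k, ∀ t, ∫ σ in (0 : ℝ)..P, g l t σ = 0) (n : ℕ) :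
    ∀ i l, i + n ≤ k → l + n ≤ k → ∀ b,
      ‖∫ τ in α..β, a i τ • g l τ (τ / e + b)‖ ≤ (2 * e * P) ^ n * (A * G * (β - α)) := by
  induction n with
  | zero =>
    intro i l hi hl b
    rw [pow_zero, one_mul]
    refine (intervalIntegral.norm_integral_le_of_norm_le_const fun τ _ => ?_).trans_eq
      (by rw [abs_of_nonneg (sub_nonneg.2 hαβ)])
    rw [norm_smul]
    exact mul_le_mul (haA i (by omega) τ) (hgG l (by omega) _ _) (norm_nonneg _)
      ((abs_nonneg _).trans (haA i (by omega) τ))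
  | succ n ih =>
    intro i l hi hl b
    have hder := hasDerivAt_integral_phase he (hac i (by omega)) (hac (i + 1) (by omega))
      (ha i (by omega)) (ha0 i (by omega)) (ha0 (i + 1) (by omega)) (hgc l (by omega))
      (hgc (l + 1) (by omega)) (hg l (by omega))
    refine (norm_le_of_periodic_of_mean_zero (C := e * (2 * ((2 * e * P) ^ n * (A * G * (β - α)))))
      hP hder (fun b => ?_) (fun b => ?_) ?_ b).trans_eq (by ring)
    · rw [norm_neg, norm_smul, Real.norm_of_nonneg he.le]
      gcongr
      refine (norm_add_le _ _).trans ?_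
      linarith [ih (i + 1) l (by omega) (by omega) b, ih i (l + 1) (by omega) (by omega) b]
    · refine intervalIntegral.integral_congr fun τ _ => ?_
      simp only [← add_assoc, hper l (by omega) τ _]
    · have hc : Continuous fun q : ℝ × ℝ => a i q.2 • g l q.2 (q.2 / e + q.1) :=
        ((hac i (by omega)).comp continuous_snd).smul ((hgc l (by omega)).comp
          (by fun_prop : Continuous fun q : ℝ × ℝ => (q.2, q.2 / e + q.1)))
      have hsw : ∫ b in (0 : ℝ)..P, ∫ τ in α..β, a i τ • g l τ (τ / e + b) =
          ∫ τ in α..β, ∫ b in (0 : ℝ)..P, a i τ • g l τ (τ / e + b) := by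
        simp only [intervalIntegral.integral_of_le hαβ]
        refine intervalIntegral_integral_swap ?_
        rw [uIoc_of_le hP.le, Measure.prod_restrict]
        exact (hc.continuousOn.integrableOn_compact (isCompact_Icc.prod isCompact_Icc)).mono_set
          (prod_mono Ioc_subset_Icc_self Ioc_subset_Icc_self)
      rw [hsw]
      refine (intervalIntegral.integral_congr (g := fun _ => (0 : U)) fun τ _ => ?_).trans (by simp)
      simp only [intervalIntegral.integral_smul, intervalIntegral.integral_comp_add_left (g l τ)]
      rw [add_zero, (hper l (by omega) τ).intervalIntegral_add_eq _ 0, zero_add,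
        hmean l (by omega), smul_zero]

/-! ### The kernel on a window -/

theorem IsKernel.iteratedDeriv_eq_zero {p k : ℕ} {K : ℝ → ℝ} (hK : IsKernel p k K) {j : ℕ}
    (hj : j ≤ k) {t : ℝ} (ht : t ∉ Ioo (-1 : ℝ) 1) : iteratedDeriv j K t = 0 := by
  have hcl : IsClosed {t | iteratedDeriv j K t = 0} :=
    isClosed_eq (hK.smooth.continuous_iteratedDeriv j (by exact_mod_cast hj)) continuous_const
  have hsub : (Icc (-1 : ℝ) 1)ᶜ ⊆ {t | iteratedDeriv j K t = 0} := by
    intro s hs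
    have : K =ᶠ[𝓝 s] fun _ => 0 := by
      filter_upwards [isClosed_Icc.isOpen_compl.mem_nhds hs] with x hx using hK.support x hx
    have h2 := this.iteratedDeriv_eq j
    rw [mem_ofPred_eq, h2]
    simp
  have h1 : Iio (-1 : ℝ) ⊆ {t | iteratedDeriv j K t = 0} := fun s hs => hsub fun h => by
    have := h.1; rw [mem_Iio] at hs; linarith
  have h2 : Ioi (1 : ℝ) ⊆ {t | iteratedDeriv j K t = 0} := fun s hs => hsub fun h => by
    have := h.2; rw [mem_Ioi] at hs; linarith
  have h3 := closure_minimal h1 hcl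
  have h4 := closure_minimal h2 hcl
  rw [closure_Iio] at h3
  rw [closure_Ioi] at h4
  by_cases h : t ≤ -1
  · exact h3 h
  · refine h4 ?_
    by_contra h'
    rw [mem_Ici] at h'
    exact ht ⟨by linarith, by linarith⟩

theorem IsKernel.exists_bound {p k : ℕ} {K : ℝ → ℝ} (hK : IsKernel p k K) :
    ∃ A > 0, ∀ j ≤ k, ∀ t, |iteratedDeriv j K t| ≤ A := by
  have h : ∀ j, ∃ A : ℝ, j ≤ k → ∀ t, |iteratedDeriv j K t| ≤ A := by
    intro j
    by_cases hj : j ≤ k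
    · obtain ⟨C, hC⟩ := (isCompact_Icc (a := (-1 : ℝ)) (b := 1)).exists_bound_of_continuousOn
        (hK.smooth.continuous_iteratedDeriv j (by exact_mod_cast hj)).continuousOn
      refine ⟨C, fun _ t => ?_⟩
      by_cases ht : t ∈ Icc (-1 : ℝ) 1
      · exact hC t ht
      · rw [hK.iteratedDeriv_eq_zero hj fun h => ht (Ioo_subset_Icc_self h), abs_zero]
        exact (norm_nonneg _).trans (hC 0 (by constructor <;> norm_num))
    · exact ⟨0, fun h => absurd h hj⟩
  choose A hA using h
  refine ⟨1 + ∑ i ∈ Finset.range (k + 1), |A i|, by positivity, fun j hj t => ?_⟩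
  have h1 := Finset.single_le_sum (f := fun i => |A i|) (fun i _ => abs_nonneg _)
    (Finset.mem_range.2 (Nat.lt_succ_of_le hj))
  have h2 := hA j hj t
  have h3 := le_abs_self (A j)
  linarith

/-- The `j`-th derivative of `τ ↦ K_η(Δ - τ)`, the weight in the window `[t₀, t₀ + η]` with centre
`Δ = t₀ + η / 2`. -/
noncomputable def windowWeight (K : ℝ → ℝ) (η t₀ : ℝ) (j : ℕ) (τ : ℝ) : ℝ :=
  2 / η * (-(2 / η)) ^ j * iteratedDeriv j K (2 * (t₀ + η / 2 - τ) / η)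

theorem windowWeight_zero (K : ℝ → ℝ) (η t₀ τ : ℝ) :
    windowWeight K η t₀ 0 τ = scaledKernel K η (t₀ + η / 2 - τ) := by
  simp [windowWeight, scaledKernel]

section
variable {p k : ℕ} {K : ℝ → ℝ} {η t₀ A : ℝ}

theorem IsKernel.continuous_windowWeight (hK : IsKernel p k K) {j : ℕ} (hj : j ≤ k) :
    Continuous (windowWeight K η t₀ j) := by
  have := hK.smooth.continuous_iteratedDeriv j (by exact_mod_cast hj)
  unfold windowWeight
  fun_prop

theorem IsKernel.hasDerivAt_windowWeight (hK : IsKernel p k K) {j : ℕ} (hj : j < k) (τ : ℝ) :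
    HasDerivAt (windowWeight K η t₀ j) (windowWeight K η t₀ (j + 1) τ) τ := by
  have h1 := (hK.smooth.differentiable_iteratedDeriv j (by exact_mod_cast hj)
    (2 * (t₀ + η / 2 - τ) / η)).hasDerivAt
  have h2 : HasDerivAt (fun τ => 2 * (t₀ + η / 2 - τ) / η) (-(2 / η)) τ := by
    refine ((((hasDerivAt_id τ).const_sub (t₀ + η / 2)).const_mul 2).div_const η).congr_deriv ?_
    ring
  refine ((h1.comp τ h2).const_mul (2 / η * (-(2 / η)) ^ j)).congr_deriv ?_
  rw [windowWeight, iteratedDeriv_succ]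
  ring

theorem IsKernel.windowWeight_eq_zero (hK : IsKernel p k K) (hη : 0 < η) {j : ℕ} (hj : j ≤ k)
    {τ : ℝ} (hτ : τ ∉ Ioo t₀ (t₀ + η)) : windowWeight K η t₀ j τ = 0 := by
  rw [windowWeight, hK.iteratedDeriv_eq_zero hj, mul_zero]
  intro h
  refine hτ ?_
  rw [mem_Ioo, lt_div_iff₀ hη, div_lt_iff₀ hη] at h
  constructor <;> linarith [h.1, h.2]

theorem abs_windowWeight_le (hη : 0 < η) {j : ℕ} (hA : ∀ t, |iteratedDeriv j K t| ≤ A) (τ : ℝ) :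
    |windowWeight K η t₀ j τ| ≤ A * (2 / η) ^ (j + 1) := by
  rw [windowWeight, abs_mul, abs_mul, abs_pow, abs_neg, abs_of_pos (by positivity : 0 < 2 / η),
    ← pow_succ', mul_comm]
  gcongr
  exact hA _

theorem IsKernel.deriv_scaledKernel (hK : IsKernel p k K) (hk : 1 ≤ k) (τ : ℝ) :
    deriv (scaledKernel K η) (t₀ + η / 2 - τ) = -windowWeight K η t₀ 1 τ := by
  have h := hK.hasDerivAt_windowWeight (η := η) (t₀ := t₀) (j := 0) (by omega) τ
  have h2 : HasDerivAt (fun s => t₀ + η / 2 - s) (-1) (t₀ + η / 2 - τ) :=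
    (hasDerivAt_id _).const_sub _
  have h3 : HasDerivAt (scaledKernel K η) (-windowWeight K η t₀ 1 τ) (t₀ + η / 2 - τ) := by
    have h' : HasDerivAt (windowWeight K η t₀ 0) (windowWeight K η t₀ 1 τ)
      (t₀ + η / 2 - (t₀ + η / 2 - τ)) := by simpa using h
    refine ((h'.comp _ h2).congr_of_eventuallyEq (Eventually.of_forall fun s => ?_)).congr_deriv
      (by ring)
    simp [windowWeight_zero]
  exact h3.deriv

variable {U : Type*} [NormedAddCommGroup U] [NormedSpace ℝ U]

theorem SmoothProfile.continuous {g : ℝ → ℝ → U} (hg : SmoothProfile k g) :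
    Continuous (Function.uncurry g) := by
  have := hg.2 0 (Nat.zero_le k)
  simp only [iteratedDeriv_zero] at this
  exact this

theorem SmoothProfile.hasDerivAt {g : ℝ → ℝ → U} (hg : SmoothProfile k g) {l : ℕ} (hl : l < k)
    (σ t : ℝ) : HasDerivAt (fun t => iteratedDeriv l (fun t' => g t' σ) t)
      (iteratedDeriv (l + 1) (fun t' => g t' σ) t) t := by
  rw [iteratedDeriv_succ]
  exact ((hg.1 σ).differentiable_iteratedDeriv l (by exact_mod_cast hl) t).hasDerivAt

/-! ### Averages of slow, oscillatory and dissipative parts -/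

/-- `xⁿ e^{-x} ≤ 2ⁿ n! e^{-x/2}`. -/
theorem pow_mul_exp_neg_le (n : ℕ) {x : ℝ} (hx : 0 ≤ x) :
    x ^ n * Real.exp (-x) ≤ 2 ^ n * n.factorial * Real.exp (-(x / 2)) := by
  have h := Real.pow_div_factorial_le_exp (x / 2) (by positivity) n
  rw [div_le_iff₀ (by positivity), div_pow, div_le_iff₀ (by positivity)] at h
  have h2 : Real.exp (-x) = Real.exp (-(x / 2)) * Real.exp (-(x / 2)) := by
    rw [← Real.exp_add]; ring_nf
  have h3 : Real.exp (x / 2) * Real.exp (-(x / 2)) = 1 := by rw [← Real.exp_add]; simp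
  calc x ^ n * Real.exp (-x) ≤ (Real.exp (x / 2) * n.factorial * 2 ^ n) * Real.exp (-x) := by
        gcongr
    _ = (Real.exp (x / 2) * Real.exp (-(x / 2))) * (2 ^ n * n.factorial * Real.exp (-(x / 2))) := by
        rw [h2]; ring
    _ = _ := by rw [h3, one_mul]

/-- A transient of amplitude one averages to `O(e^(n+1) / η^(n+1))`, because it is concentrated
near the end of the window, where the kernel vanishes to order `n`. -/
theorem IsKernel.norm_average_dissipative_le (hK : IsKernel p k K) (hη : 0 < η)
    {n : ℕ} (hn : n ≤ k) (hA : ∀ t, |iteratedDeriv n K t| ≤ A) {d : ℝ → ℝ → U} {M e : ℝ}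
    (he : 0 < e) (hM : 0 < M) (hd : IsDissipative k M d) :
    ‖∫ τ in t₀..(t₀ + η), windowWeight K η t₀ 0 τ • d τ ((τ - t₀) / e)‖ ≤
      A * (2 / η) ^ (n + 1) * (M * (e * M) ^ n * (2 ^ n * n.factorial)) * (2 * (e * M)) := by
  have hA0 : 0 ≤ A := (abs_nonneg _).trans (hA 0)
  -- the kernel vanishes to order `n` at `1`, which corresponds to `τ = t₀`
  have hvan : ∀ τ ∈ Icc t₀ (t₀ + η),
      |windowWeight K η t₀ 0 τ| ≤ A * (2 / η) ^ (n + 1) * (τ - t₀) ^ n := by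
    intro τ hτ
    have hmem : 2 * (t₀ + η / 2 - τ) / η ∈ Icc (-1 : ℝ) 1 := by
      rw [mem_Icc, le_div_iff₀ hη, div_le_iff₀ hη]
      constructor <;> linarith [hτ.1, hτ.2]
    have h := norm_sub_taylor_le n (hK.smooth.of_le (by exact_mod_cast hn)) (fun t _ => hA t)
      1 (by constructor <;> norm_num) _ hmem
    rw [Finset.sum_eq_zero, sub_zero] at h
    · have h2 : |2 * (t₀ + η / 2 - τ) / η - 1| = 2 / η * (τ - t₀) := by
        rw [abs_of_nonpos (by linarith [hmem.2])]
        field_simp; ring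
      rw [h2, Real.norm_eq_abs] at h
      rw [windowWeight, pow_zero, mul_one, iteratedDeriv_zero, abs_mul,
        abs_of_pos (by positivity : 0 < 2 / η)]
      calc 2 / η * |K (2 * (t₀ + η / 2 - τ) / η)| ≤ 2 / η * (A * (2 / η * (τ - t₀)) ^ n) := by
            gcongr
        _ = _ := by rw [mul_pow]; ring
    · intro j hj
      rw [hK.iteratedDeriv_eq_zero ((Finset.mem_range.1 hj).le.trans hn) (by simp), smul_zero]
  set B := A * (2 / η) ^ (n + 1) * (M * (e * M) ^ n * (2 ^ n * n.factorial)) with hB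
  have hB0 : 0 ≤ B := by positivity
  have hpt : ∀ τ ∈ Icc t₀ (t₀ + η), ‖windowWeight K η t₀ 0 τ • d τ ((τ - t₀) / e)‖ ≤
      B * Real.exp (-((τ - t₀) / (e * M) / 2)) := by
    intro τ hτ
    have hx : 0 ≤ (τ - t₀) / (e * M) := div_nonneg (by linarith [hτ.1]) (by positivity)
    have h1 := hd.bound 0 (Nat.zero_le k) τ ((τ - t₀) / e) (div_nonneg (by linarith [hτ.1]) he.le)
    have h2 : -((τ - t₀) / e) / M = -((τ - t₀) / (e * M)) := by field_simp
    rw [iteratedDeriv_zero, h2] at h1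
    have h3 : (τ - t₀) ^ n = (e * M) ^ n * ((τ - t₀) / (e * M)) ^ n := by
      rw [← mul_pow]; congr 1; field_simp
    rw [norm_smul, Real.norm_eq_abs]
    calc _ ≤ (A * (2 / η) ^ (n + 1) * (τ - t₀) ^ n) * (M * Real.exp (-((τ - t₀) / (e * M)))) := by
          refine mul_le_mul (hvan τ hτ) h1 (norm_nonneg _) ?_
          exact (abs_nonneg _).trans (hvan τ hτ)
      _ = A * (2 / η) ^ (n + 1) * (M * (e * M) ^ n) *
          (((τ - t₀) / (e * M)) ^ n * Real.exp (-((τ - t₀) / (e * M)))) := by rw [h3]; ring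
      _ ≤ A * (2 / η) ^ (n + 1) * (M * (e * M) ^ n) *
          (2 ^ n * n.factorial * Real.exp (-((τ - t₀) / (e * M) / 2))) := by
          exact mul_le_mul_of_nonneg_left (pow_mul_exp_neg_le n hx) (by positivity)
      _ = _ := by rw [hB]; ring
  have hle : t₀ ≤ t₀ + η := by linarith
  have hprim : ∀ τ : ℝ, HasDerivAt
      (fun τ => -(2 * (e * M)) * B * Real.exp (-((τ - t₀) / (e * M) / 2)))
      (B * Real.exp (-((τ - t₀) / (e * M) / 2))) τ := by
    intro τ
    have h1 : HasDerivAt (fun τ => -((τ - t₀) / (e * M) / 2)) (-(1 / (e * M) / 2)) τ :=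
      ((((hasDerivAt_id τ).sub_const t₀).div_const (e * M)).div_const 2).neg
    refine (h1.exp.const_mul (-(2 * (e * M)) * B)).congr_deriv ?_
    field_simp
  refine (intervalIntegral.norm_integral_le_of_norm_le hle
    (Eventually.of_forall fun τ hτ => hpt τ (Ioc_subset_Icc_self hτ))
    (Continuous.intervalIntegrable (by fun_prop) _ _)).trans ?_
  rw [intervalIntegral.integral_eq_sub_of_hasDerivAt (fun τ _ => hprim τ)
    (Continuous.intervalIntegrable (by fun_prop) _ _)]
  simp only [sub_self, zero_div, neg_zero, Real.exp_zero]
  have : 0 ≤ 2 * (e * M) * B * Real.exp (-((t₀ + η - t₀) / (e * M) / 2)) := by positivity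
  linarith
variable [CompleteSpace U]

/-- The derivative falling on the kernel is moved onto the state: `K_η' * z = K_η * z'`. -/
theorem IsKernel.kernelForce_eq (hK : IsKernel p k K) (hk : 1 ≤ k) (hη : 0 < η) {z w : ℝ → U}
    (hz : ∀ t ∈ Icc t₀ (t₀ + η), HasDerivWithinAt z (w t) (Icc t₀ (t₀ + η)) t)
    (hw : ContinuousOn w (Icc t₀ (t₀ + η))) :
    kernelForce K η t₀ z = ∫ τ in t₀..(t₀ + η), windowWeight K η t₀ 0 τ • w τ := by
  have hle : t₀ ≤ t₀ + η := by linarith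
  have h := intervalIntegral.integral_smul_deriv_eq_deriv_smul_of_hasDerivAt
    (a := t₀) (b := t₀ + η) (u := windowWeight K η t₀ 0) (u' := windowWeight K η t₀ 1) (v := z)
    (v' := w) (hK.continuous_windowWeight (Nat.zero_le k)).continuousOn
    (by rw [uIcc_of_le hle]; exact fun t ht => (hz t ht).continuousWithinAt)
    (fun t _ => hK.hasDerivAt_windowWeight (by omega) t)
    (by
      rw [min_eq_left hle, max_eq_right hle]
      exact fun t ht => (hz t (Ioo_subset_Icc_self ht)).hasDerivAt (Icc_mem_nhds ht.1 ht.2))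
    ((hK.continuous_windowWeight hk).intervalIntegrable _ _)
    (ContinuousOn.intervalIntegrable (by rwa [uIcc_of_le hle]))
  rw [h, hK.windowWeight_eq_zero hη (Nat.zero_le k) (by simp),
    hK.windowWeight_eq_zero hη (Nat.zero_le k) (by simp), kernelForce]
  simp only [zero_smul, sub_zero, zero_sub, hK.deriv_scaledKernel hk, neg_smul,
    intervalIntegral.integral_neg]

theorem IsKernel.integral_windowWeight_mul_pow (hK : IsKernel p k K) (hη : 0 < η) {j : ℕ}
    (hj : j ≤ p) :
    ∫ τ in t₀..(t₀ + η), windowWeight K η t₀ 0 τ * (τ - (t₀ + η / 2)) ^ j =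
      if j = 0 then 1 else 0 := by
  have h1 : ∀ τ, windowWeight K η t₀ 0 τ * (τ - (t₀ + η / 2)) ^ j =
      (fun s => 2 / η * (-(η / 2)) ^ j * (K s * s ^ j)) (2 * (t₀ + η / 2) / η - 2 / η * τ) := by
    intro τ
    have h2 : 2 * (t₀ + η / 2) / η - 2 / η * τ = 2 * (t₀ + η / 2 - τ) / η := by ring
    have h3 : τ - (t₀ + η / 2) = -(η / 2) * (2 * (t₀ + η / 2 - τ) / η) := by field_simp; ring
    simp only [h2]
    rw [h3, mul_pow, windowWeight]
    simp only [pow_zero, iteratedDeriv_zero]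
    ring
  rw [intervalIntegral.integral_congr fun τ _ => h1 τ,
    intervalIntegral.integral_comp_sub_mul (fun s => 2 / η * (-(η / 2)) ^ j * (K s * s ^ j))
      (by positivity)]
  have h4 : 2 * (t₀ + η / 2) / η - 2 / η * (t₀ + η) = -1 := by field_simp; ring
  have h5 : 2 * (t₀ + η / 2) / η - 2 / η * t₀ = 1 := by field_simp; ring
  rw [h4, h5, intervalIntegral.integral_const_mul,
    intervalIntegral.integral_eq_integral_of_support_subset]
  · split_ifs with h
    · subst h
      simp only [pow_zero, mul_one, hK.mass, smul_eq_mul]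
      field_simp
    · rw [hK.moments j (by omega) hj]; simp
  · intro s hs
    by_contra h
    have : K s = 0 := by
      have := hK.iteratedDeriv_eq_zero (Nat.zero_le k) (t := s) fun h' => h ⟨h'.1, h'.2.le⟩
      simpa using this
    exact hs (by simp [this])

/-- Averaging a slow function of class `C^p` costs `O(η^p)`, because the kernel reproduces the
Taylor polynomial. -/
theorem IsKernel.norm_average_sub_le (hK : IsKernel p k K) (hη : 0 < η)
    (hA : ∀ t, |iteratedDeriv 0 K t| ≤ A) {f : ℝ → U} {M : ℝ} (hf : ContDiff ℝ p f)
    (hM : ∀ t ∈ Icc t₀ (t₀ + η), ‖iteratedDeriv p f t‖ ≤ M) (hp : 1 ≤ p) :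
    ‖(∫ τ in t₀..(t₀ + η), windowWeight K η t₀ 0 τ • f τ) - f (t₀ + η / 2)‖ ≤
      2 * A * M * η ^ p := by
  set Δ := t₀ + η / 2 with hΔ
  have hΔm : Δ ∈ Icc t₀ (t₀ + η) := ⟨by linarith, by linarith⟩
  have hM0 : 0 ≤ M := (norm_nonneg _).trans (hM Δ hΔm)
  have hA0 : 0 ≤ A := (abs_nonneg _).trans (hA 0)
  have hwc : Continuous (windowWeight K η t₀ 0) := hK.continuous_windowWeight (Nat.zero_le k)
  set P : ℝ → U := fun τ => ∑ j ∈ Finset.range p,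
    ((τ - Δ) ^ j / (j.factorial : ℝ)) • iteratedDeriv j f Δ with hP
  have hPc : Continuous P := by
    refine continuous_finsetSum _ fun j _ => ?_
    exact Continuous.smul (by fun_prop) continuous_const
  have hPi : ∫ τ in t₀..(t₀ + η), windowWeight K η t₀ 0 τ • P τ = f Δ := by
    simp only [hP, Finset.smul_sum, smul_smul]
    rw [intervalIntegral.integral_finsetSum]
    · have : ∀ j ∈ Finset.range p, ∫ τ in t₀..(t₀ + η),
          (windowWeight K η t₀ 0 τ * ((τ - Δ) ^ j / (j.factorial : ℝ))) • iteratedDeriv j f Δ =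
          if j = 0 then f Δ else 0 := by
        intro j hj
        rw [intervalIntegral.integral_smul_const]
        simp only [← mul_div_assoc]
        rw [intervalIntegral.integral_div,
          hK.integral_windowWeight_mul_pow hη (Finset.mem_range.1 hj).le]
        split_ifs with h
        · subst h; simp
        · simp
      rw [Finset.sum_congr rfl this]
      simp [show 0 < p from hp]
    · intro j _
      refine Continuous.intervalIntegrable ?_ _ _
      exact Continuous.smul (by fun_prop) continuous_const
  have hi1 : Continuous fun τ => windowWeight K η t₀ 0 τ • f τ := hwc.smul hf.continuous
  have hi2 : Continuous fun τ => windowWeight K η t₀ 0 τ • P τ := hwc.smul hPc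
  rw [← hPi, ← intervalIntegral.integral_sub (hi1.intervalIntegrable _ _)
    (hi2.intervalIntegrable _ _)]
  refine (intervalIntegral.norm_integral_le_of_norm_le_const (C := A * (2 / η) * (M * η ^ p))
    fun τ hτ => ?_).trans_eq ?_
  · rw [uIoc_of_le (by linarith)] at hτ
    have hτ' := Ioc_subset_Icc_self hτ
    rw [← smul_sub, norm_smul]
    refine mul_le_mul (by simpa using abs_windowWeight_le hη hA τ) ?_ (norm_nonneg _)
      (by positivity)
    refine (norm_sub_taylor_le p hf hM Δ hΔm τ hτ').trans ?_
    gcongr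
    rw [abs_le]
    constructor <;> linarith [hτ'.1, hτ'.2]
  · rw [add_sub_cancel_left, abs_of_pos hη]; field_simp

/-- An oscillation of amplitude one averages to `O(e^k / η^k)`. -/
theorem IsKernel.norm_average_oscillatory_le (hK : IsKernel p k K) (hη : 0 < η) (hη1 : η ≤ 1)
    (hA : ∀ j ≤ k, ∀ t, |iteratedDeriv j K t| ≤ A) {g : ℝ → ℝ → U} {M e : ℝ} (he : 0 < e)
    (hg : IsOscillatory k M g) :
    ‖∫ τ in t₀..(t₀ + η), windowWeight K η t₀ 0 τ • g τ ((τ - t₀) / e)‖ ≤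
      (2 * e * M) ^ k * (A * (2 / η) ^ (k + 1) * M * η) := by
  obtain ⟨P, hP, hPM, hper⟩ := hg.periodic
  have hA0 : 0 ≤ A := (abs_nonneg _).trans (hA 0 (Nat.zero_le k) 0)
  have hM : 0 < M := hP.trans_le hPM
  have h2η : 1 ≤ 2 / η := by rw [le_div_iff₀ hη]; linarith
  have hp' : ∀ l ≤ k, ∀ t,
      Function.Periodic (fun σ => iteratedDeriv l (fun t' => g t' σ) t) P := by
    intro l _ t σ
    have : (fun t' => g t' (σ + P)) = fun t' => g t' σ := funext fun t' => (hper t').1 σ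
    simp only [this]
  have hmean : ∀ l ≤ k, ∀ t, ∫ σ in (0 : ℝ)..P, iteratedDeriv l (fun t' => g t' σ) t = 0 := by
    intro l
    induction l with
    | zero => intro _ t; simpa using (hper t).2
    | succ l ih =>
      intro hl t
      have hd := hasDerivAt_intervalIntegral_of_continuous
        (F := fun t σ => iteratedDeriv l (fun t' => g t' σ) t)
        (F' := fun t σ => iteratedDeriv (l + 1) (fun t' => g t' σ) t)
        (hg.smooth.2 l (by omega)) (hg.smooth.2 (l + 1) hl)
        (fun t σ => hg.smooth.hasDerivAt (by omega) σ t) 0 P t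
      simp only [ih (by omega)] at hd
      exact hd.unique (hasDerivAt_const t (0 : U))
  have key := norm_integral_oscillation_le (k := k) (a := windowWeight K η t₀)
    (g := fun l t σ => iteratedDeriv l (fun t' => g t' σ) t) (α := t₀) (β := t₀ + η) (e := e)
    (P := P) (A := A * (2 / η) ^ (k + 1)) (G := M) (by linarith) he hP
    (fun i hi => hK.continuous_windowWeight hi) (fun i hi t => hK.hasDerivAt_windowWeight hi t)
    (fun i hi t ht => hK.windowWeight_eq_zero hη hi ht)
    (fun i hi t => (abs_windowWeight_le hη (hA i hi) t).trans (by gcongr))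
    (fun l hl => hg.smooth.2 l hl) (fun l hl σ t => hg.smooth.hasDerivAt hl σ t)
    (fun l hl t σ => hg.bound l hl t σ) hp' hmean k 0 0 (by omega) (by omega) (-t₀ / e)
  simp only [iteratedDeriv_zero, add_sub_cancel_left] at key
  have hrw : ∀ τ : ℝ, (τ - t₀) / e = τ / e + -t₀ / e := fun τ => by ring
  simp only [hrw]
  refine key.trans ?_
  gcongr

end

/-- The kernel estimate for the exact micro-solution: smoothing error of the slow part, residue of
the fast dynamics, and remainder. -/
theorem IsKernel.exists_norm_kernelForce_sub_le {p k J : ℕ} {K : ℝ → ℝ} (hK : IsKernel p k K)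
    (hk : 1 ≤ k) (hp : 1 ≤ p) {M : ℝ} (hM : 0 < M) {U : Type*} [NormedAddCommGroup U]
    [NormedSpace ℝ U] [CompleteSpace U] :
    ∃ C > 0, ∀ (e η t₀ T : ℝ) (z w v : ℝ → U), 0 < e → 0 < η → η ≤ 1 → η < T →
      HasFastSlowSplitting k J M e t₀ T w v → ContDiff ℝ p v →
      (∀ t ∈ Icc t₀ (t₀ + T), ‖iteratedDeriv p v t‖ ≤ M) → SolvesOn (fun t _ => w t) z t₀ (t₀ + η) →
      ContinuousOn w (Icc t₀ (t₀ + η)) →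
      ‖kernelForce K η t₀ z - v (t₀ + η / 2)‖ ≤ C * (η ^ p + e ^ (k - 1) / η ^ k + e) := by
  obtain ⟨A, hA0, hA⟩ := hK.exists_bound
  obtain ⟨n, rfl⟩ : ∃ n, k = n + 1 := ⟨k - 1, by omega⟩
  set C₁ := (2 * M) ^ (n + 1) * (A * 2 ^ (n + 2) * M) with hC₁
  set C₂ := A * 2 ^ (n + 1) * (M * M ^ n * (2 ^ n * n.factorial)) * (2 * M) with hC₂
  have hC₁0 : 0 ≤ C₁ := by positivity
  have hC₂0 : 0 ≤ C₂ := by positivity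
  refine ⟨2 * A * M + (J * C₁ + C₂), by positivity, ?_⟩
  intro e η t₀ T z w v he hη hη1 hηT ⟨osc, diss, hosc, hdiss, hsplit⟩ hv hvM hz hw
  have hle : t₀ ≤ t₀ + η := by linarith
  rw [hK.kernelForce_eq hk hη hz hw]
  set W := windowWeight K η t₀ 0 with hW
  have hWc : Continuous W := hK.continuous_windowWeight (Nat.zero_le _)
  have hprof : ∀ f : ℝ → ℝ → U, SmoothProfile (n + 1) f →
      Continuous fun τ => W τ • f τ ((τ - t₀) / e) := fun f hf =>
    hWc.smul (hf.continuous.comp (by fun_prop : Continuous fun τ : ℝ => (τ, (τ - t₀) / e)))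
  have hslow := hK.norm_average_sub_le hη (hA 0 (Nat.zero_le _)) hv
    (fun t ht => hvM t ⟨ht.1, by linarith [ht.2]⟩) hp
  have hfo : ∀ i, ‖∫ τ in t₀..(t₀ + η), W τ • osc i τ ((τ - t₀) / e)‖ ≤
      e * (C₁ * (e ^ n / η ^ (n + 1))) := fun i => by
    refine (hK.norm_average_oscillatory_le hη hη1 hA he (hosc i)).trans_eq ?_
    rw [hC₁, div_pow, mul_pow, mul_pow, mul_pow]; field_simp; ring
  have hfd : ‖∫ τ in t₀..(t₀ + η), W τ • diss τ ((τ - t₀) / e)‖ ≤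
      e * (C₂ * (e ^ n / η ^ (n + 1))) := by
    refine (hK.norm_average_dissipative_le hη (Nat.le_succ n) (hA n (Nat.le_succ n)) he hM
      hdiss).trans_eq ?_
    rw [hC₂, mul_pow, div_pow]; field_simp
  have hWw : IntervalIntegrable (fun τ => W τ • w τ) volume t₀ (t₀ + η) := by
    refine ContinuousOn.intervalIntegrable ?_
    rw [uIcc_of_le hle]; exact hWc.continuousOn.smul hw
  have hWv : IntervalIntegrable (fun τ => W τ • v τ) volume t₀ (t₀ + η) :=
    Continuous.intervalIntegrable (hWc.smul hv.continuous) _ _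
  have hWo : ∀ i, IntervalIntegrable (fun τ => W τ • osc i τ ((τ - t₀) / e)) volume t₀ (t₀ + η) :=
    fun i => (hprof _ (hosc i).smooth).intervalIntegrable _ _
  have hWd : IntervalIntegrable (fun τ => W τ • diss τ ((τ - t₀) / e)) volume t₀ (t₀ + η) :=
    (hprof _ hdiss.smooth).intervalIntegrable _ _
  have hrem : ‖∫ τ in t₀..(t₀ + η), W τ • (w τ - v τ -
      e⁻¹ • (∑ i, osc i τ ((τ - t₀) / e) + diss τ ((τ - t₀) / e)))‖ ≤ 2 * A * M * e := by
    refine (intervalIntegral.norm_integral_le_of_norm_le_const (C := A * (2 / η) * (M * e))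
      fun τ hτ => ?_).trans_eq ?_
    · rw [uIoc_of_le hle] at hτ
      rw [norm_smul]
      refine mul_le_mul ?_ (hsplit τ ⟨hτ.1.le, by linarith [hτ.2]⟩) (norm_nonneg _) (by positivity)
      simpa using abs_windowWeight_le hη (hA 0 (Nat.zero_le _)) τ
    · rw [add_sub_cancel_left, abs_of_pos hη]; field_simp
  have hWo' : IntervalIntegrable (fun τ => ∑ i, W τ • osc i τ ((τ - t₀) / e)) volume t₀ (t₀ + η) :=
    (continuous_finsetSum _ fun i _ => hprof _ (hosc i).smooth).intervalIntegrable _ _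
  have hWwv : IntervalIntegrable (fun τ => W τ • w τ - W τ • v τ) volume t₀ (t₀ + η) :=
    hWw.sub hWv
  have hWx : IntervalIntegrable (fun τ => e⁻¹ • (∑ i, W τ • osc i τ ((τ - t₀) / e) +
      W τ • diss τ ((τ - t₀) / e))) volume t₀ (t₀ + η) := (hWo'.add hWd).smul e⁻¹
  have hexp : ∫ τ in t₀..(t₀ + η), W τ • (w τ - v τ -
      e⁻¹ • (∑ i, osc i τ ((τ - t₀) / e) + diss τ ((τ - t₀) / e))) =
      (∫ τ in t₀..(t₀ + η), W τ • w τ) - (∫ τ in t₀..(t₀ + η), W τ • v τ) -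
      e⁻¹ • (∑ i, (∫ τ in t₀..(t₀ + η), W τ • osc i τ ((τ - t₀) / e)) +
        ∫ τ in t₀..(t₀ + η), W τ • diss τ ((τ - t₀) / e)) := by
    rw [← intervalIntegral.integral_finsetSum fun i _ => hWo i,
      ← intervalIntegral.integral_add hWo' hWd, ← intervalIntegral.integral_sub hWw hWv,
      ← intervalIntegral.integral_smul,
      ← intervalIntegral.integral_sub hWwv hWx]
    refine intervalIntegral.integral_congr fun τ _ => ?_
    simp only [smul_sub, smul_add, Finset.smul_sum, smul_comm (W τ) e⁻¹]
  rw [hexp] at hrem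
  have hfast : ‖e⁻¹ • (∑ i, (∫ τ in t₀..(t₀ + η), W τ • osc i τ ((τ - t₀) / e)) +
      ∫ τ in t₀..(t₀ + η), W τ • diss τ ((τ - t₀) / e))‖ ≤
      (J * C₁ + C₂) * (e ^ n / η ^ (n + 1)) := by
    rw [norm_smul, norm_inv, Real.norm_of_nonneg he.le]
    calc _ ≤ e⁻¹ * (∑ _i : Fin J, e * (C₁ * (e ^ n / η ^ (n + 1))) +
          e * (C₂ * (e ^ n / η ^ (n + 1)))) := by
          gcongr
          refine (norm_add_le _ _).trans (add_le_add ?_ hfd)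
          exact norm_sum_le_of_le _ fun i _ => hfo i
      _ = _ := by
          rw [Finset.sum_const, Finset.card_univ, Fintype.card_fin, nsmul_eq_mul]
          field_simp
  set I := ∫ τ in t₀..(t₀ + η), W τ • w τ
  set V := ∫ τ in t₀..(t₀ + η), W τ • v τ
  set X := e⁻¹ • (∑ i, (∫ τ in t₀..(t₀ + η), W τ • osc i τ ((τ - t₀) / e)) +
      ∫ τ in t₀..(t₀ + η), W τ • diss τ ((τ - t₀) / e))
  have hsum : I - v (t₀ + η / 2) = (I - V - X) + (V - v (t₀ + η / 2)) + X := by abel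
  rw [hsum, Nat.add_sub_cancel]
  have h3 := norm_add₃_le (a := I - V - X) (b := V - v (t₀ + η / 2)) (c := X)
  have hp0 : 0 ≤ η ^ p := by positivity
  have hq0 : 0 ≤ e ^ n / η ^ (n + 1) := by positivity
  have hAM : 0 ≤ 2 * A * M := by positivity
  have hJ : 0 ≤ (J * C₁ + C₂) := by positivity
  nlinarith [mul_nonneg hJ hp0, mul_nonneg hJ he.le, mul_nonneg hAM hq0]

/-! ### The error of the micro-solver -/

theorem norm_iteratedFDeriv_stiffField_le {n₁ n₂ r : ℕ} {fI : ℝ → MicroState n₁ n₂ → Vec n₁}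
    {fII : ℝ → MicroState n₁ n₂ → Vec n₂} (hI : ContDiff ℝ r (Function.uncurry fI))
    (hII : ContDiff ℝ r (Function.uncurry fII)) (ε : FastMat n₂) {j : ℕ} (hj : j ≤ r) {M L : ℝ}
    {q : ℝ × MicroState n₁ n₂} (hMI : ‖iteratedFDeriv ℝ j (Function.uncurry fI) q‖ ≤ M)
    (hMII : ‖iteratedFDeriv ℝ j (Function.uncurry fII) q‖ ≤ M) (hL : M ≤ L)
    (hL' : matNorm ε.symm * M ≤ L) :
    ‖iteratedFDeriv ℝ j (Function.uncurry (stiffField fI fII ε)) q‖ ≤ L := by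
  have hII' : ContDiff ℝ r (fun q => ε.symm (Function.uncurry fII q)) :=
    ε.symm.contDiff.comp hII
  have h := iteratedFDeriv_prodMk (x := q) hI.contDiffAt hII'.contDiffAt
    (i := j) (by exact_mod_cast hj)
  have heq : Function.uncurry (stiffField fI fII ε) =
      fun q => (Function.uncurry fI q, ε.symm (Function.uncurry fII q)) := rfl
  rw [heq, h, ContinuousMultilinearMap.opNorm_prod]
  refine max_le (hMI.trans hL) (le_trans ?_ hL')
  refine (ContinuousLinearMap.norm_iteratedFDeriv_comp_left
    (ε.symm : Vec n₂ →L[ℝ] Vec n₂) hII.contDiffAt (by exact_mod_cast hj)).trans ?_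
  exact mul_le_mul_of_nonneg_left hMII (norm_nonneg _)

theorem contDiff_stiffField {n₁ n₂ r : ℕ} {fI : ℝ → MicroState n₁ n₂ → Vec n₁}
    {fII : ℝ → MicroState n₁ n₂ → Vec n₂} (hI : ContDiff ℝ r (Function.uncurry fI))
    (hII : ContDiff ℝ r (Function.uncurry fII)) (ε : FastMat n₂) :
    ContDiff ℝ r (Function.uncurry (stiffField fI fII ε)) :=
  hI.prodMk (ε.symm.contDiff.comp hII)

theorem intervalIntegrable_microPath {E : Type*} [NormedAddCommGroup E] {Φ : OneStep E}
    {g : ℝ → E → E} {t₀ h : ℝ} {N : ℕ} (hh : 0 < h) {x₀ : E}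
    (hcont : ∀ j < N, ContinuousOn
      (fun s => Φ g s (t₀ + j * h) (microGrid Φ g h t₀ x₀ j)) (Icc 0 h)) :
    IntervalIntegrable (microPath Φ g h t₀ x₀) volume t₀ (t₀ + N * h) := by
  have key := IntervalIntegrable.trans_iterate (μ := volume) (f := microPath Φ g h t₀ x₀)
    (a := fun j : ℕ => t₀ + j * h) (n := N) ?_
  · simpa using key
  intro j hj
  have hlt : t₀ + (j : ℝ) * h ≤ t₀ + ((j + 1 : ℕ) : ℝ) * h := by push_cast; nlinarith
  have hc : ContinuousOn (fun τ => Φ g (τ - (t₀ + j * h)) (t₀ + j * h) (microGrid Φ g h t₀ x₀ j))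
      (uIcc (t₀ + (j : ℝ) * h) (t₀ + ((j + 1 : ℕ) : ℝ) * h)) := by
    rw [uIcc_of_le hlt]
    refine (hcont j hj).comp (f := fun τ => τ - (t₀ + j * h)) (by fun_prop) fun τ hτ => ?_
    have h2 := hτ.2
    push_cast at h2
    exact ⟨by linarith [hτ.1], by linarith⟩
  refine hc.intervalIntegrable.congr_ae ?_
  rw [uIoc_of_le hlt]
  -- the right end point belongs to the next step, but is negligible
  rw [← Measure.restrict_congr_set Ioo_ae_eq_Ioc]
  refine (ae_restrict_iff' measurableSet_Ioo).2 (Eventually.of_forall fun τ hτ => ?_)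
  have hfl : ⌊(τ - t₀) / h⌋₊ = j := by
    have h1 := hτ.1
    have h2 := hτ.2
    push_cast at h2
    rw [Nat.floor_eq_iff (div_nonneg (by nlinarith [(Nat.cast_nonneg j : (0 : ℝ) ≤ j)]) hh.le),
      le_div_iff₀ hh, div_lt_iff₀ hh]
    constructor <;> linarith
  simp only [microPath, hfl]

section
variable {E : Type*} [NormedAddCommGroup E] [NormedSpace ℝ E] {Φ : OneStep E} {g : ℝ → E → E}
  {x : ℝ → E} {t₀ η h δ Λ L : ℝ} {r : ℕ}

/-- Local errors of order `r + 1`, accumulated over the window by stability. At an intermediate time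
the steps are full steps up to the last grid point and one shorter step. -/
theorem norm_microPath_sub_le {C ρ : ℝ} (hC : 0 < C) (hL : 1 ≤ L) (hh : 0 < h)
    (hord : ∀ (t s : ℝ) (z : ℝ → E), 0 ≤ s → s * L ≤ ρ → SolvesOn g z t (t + s) →
      (∀ τ ∈ Icc t (t + s), ∀ y ∈ Metric.closedBall (z τ) δ, ∀ j ≤ r,
        ‖iteratedFDeriv ℝ j (Function.uncurry g) (τ, y)‖ ≤ L) →
      ‖Φ g s t (z t) - z (t + s)‖ ≤ C * (s * L) ^ (r + 1))
    (hx : SolvesOn g x t₀ (t₀ + η))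
    (hbd : ∀ τ ∈ Icc t₀ (t₀ + η), ∀ y ∈ Metric.closedBall (x τ) δ, ∀ j ≤ r,
      ‖iteratedFDeriv ℝ j (Function.uncurry g) (τ, y)‖ ≤ L)
    (hst : IsStableAlong Φ g x t₀ η h δ Λ) (hδ : 0 < δ) (hΛ : 0 < Λ) (hhρ : h * L ≤ ρ)
    (hsmall : C * η * (h ^ r * L ^ (r + 1)) ≤ δ) {τ : ℝ} (hτ : τ ∈ Icc t₀ (t₀ + η)) :
    ‖microPath Φ g h t₀ (x t₀) τ - x τ‖ ≤ Λ * (C * η * (h ^ r * L ^ (r + 1))) := by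
  set j := ⌊(τ - t₀) / h⌋₊ with hj
  have hτ0 : 0 ≤ (τ - t₀) / h := div_nonneg (by linarith [hτ.1]) hh.le
  have hj1 : (j : ℝ) * h ≤ τ - t₀ := by
    rw [← le_div_iff₀ hh]; exact Nat.floor_le hτ0
  have hj2 : τ - t₀ < (j + 1) * h := by
    rw [← div_lt_iff₀ hh]; exact Nat.lt_floor_add_one _
  set s : ℕ → ℝ := fun i => if i < j then h else τ - (t₀ + j * h) with hs
  have hs_sum : ∀ i ≤ j, ∑ l ∈ Finset.range i, s l = i * h := by
    intro i hi
    rw [Finset.sum_congr rfl (g := fun _ => h)]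
    · simp
    · intro l hl
      simp [hs, (Finset.mem_range.1 hl).trans_le hi]
  have hs_last : ∑ l ∈ Finset.range (j + 1), s l = τ - t₀ := by
    rw [Finset.sum_range_succ, hs_sum j le_rfl]
    simp only [hs, lt_irrefl, if_false]
    ring
  have hs_mem : ∀ i, s i ∈ Icc 0 h := by
    intro i
    simp only [hs]
    split_ifs
    · exact ⟨hh.le, le_rfl⟩
    · constructor <;> linarith
  have hs_le : ∀ i ≤ j + 1, ∑ l ∈ Finset.range i, s l ≤ η := by
    intro i hi
    calc _ ≤ ∑ l ∈ Finset.range (j + 1), s l :=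
          Finset.sum_le_sum_of_subset_of_nonneg (Finset.range_subset_range.2 hi)
            fun l _ _ => (hs_mem l).1
      _ ≤ η := by rw [hs_last]; linarith [hτ.2]
  have hs_nonneg : ∀ i, 0 ≤ ∑ l ∈ Finset.range i, s l := fun i =>
    Finset.sum_nonneg fun l _ => (hs_mem l).1
  set v : ℕ → E := fun i => if i ≤ j then microGrid Φ g h t₀ (x t₀) i
    else microPath Φ g h t₀ (x t₀) τ with hv
  set w : ℕ → E := fun i => x (t₀ + ∑ l ∈ Finset.range i, s l) with hw
  have hloc : ∀ i < j + 1,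
      ‖w (i + 1) - Φ g (s i) (t₀ + ∑ l ∈ Finset.range i, s l) (w i)‖ ≤
        C * (h ^ r * L ^ (r + 1)) * s i := by
    intro i hi
    have hsub : Icc (t₀ + ∑ l ∈ Finset.range i, s l) (t₀ + ∑ l ∈ Finset.range i, s l + s i) ⊆
        Icc t₀ (t₀ + η) := by
      have h1 := hs_le (i + 1) (by omega)
      rw [Finset.sum_range_succ] at h1
      exact Icc_subset_Icc (by linarith [hs_nonneg i]) (by linarith)
    have h1 := hord (t₀ + ∑ l ∈ Finset.range i, s l) (s i) x (hs_mem i).1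
      ((mul_le_mul_of_nonneg_right (hs_mem i).2 (by linarith)).trans hhρ)
      (fun t ht => (hx t (hsub ht)).mono hsub) (fun t ht => hbd t (hsub ht))
    rw [norm_sub_rev]
    have h2 : w (i + 1) = x (t₀ + ∑ l ∈ Finset.range i, s l + s i) := by
      simp only [hw, Finset.sum_range_succ, add_assoc]
    rw [h2]
    refine h1.trans ?_
    have h3 : s i ^ r ≤ h ^ r := pow_le_pow_left₀ (hs_mem i).1 (hs_mem i).2 r
    calc C * (s i * L) ^ (r + 1) = C * (s i ^ r * L ^ (r + 1)) * s i := by ring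
      _ ≤ _ := by
          have := (hs_mem i).1
          gcongr
  have hsum : ∑ i ∈ Finset.range (j + 1),
      ‖w (i + 1) - Φ g (s i) (t₀ + ∑ l ∈ Finset.range i, s l) (w i)‖ ≤
        C * η * (h ^ r * L ^ (r + 1)) := by
    calc _ ≤ ∑ i ∈ Finset.range (j + 1), C * (h ^ r * L ^ (r + 1)) * s i :=
          Finset.sum_le_sum fun i hi => hloc i (Finset.mem_range.1 hi)
      _ = C * (h ^ r * L ^ (r + 1)) * (τ - t₀) := by rw [← Finset.mul_sum, hs_last]
      _ ≤ C * (h ^ r * L ^ (r + 1)) * η := by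
          gcongr; linarith [hτ.2]
      _ = _ := by ring
  have key := hst (j + 1) s v w (fun i _ => hs_mem i) (hs_le _ le_rfl) (by simp [hv, hw, microGrid])
    (by
      intro i hi
      rw [hs_sum i (by omega)]
      rcases Nat.lt_succ_iff_lt_or_eq.1 hi with hlt | rfl
      · simp [hv, hs, hlt, hlt.le, Nat.succ_le_of_lt hlt, microGrid]
      · simp [hv, hs, microPath, ← hj])
    (fun i _ => by simp [hw, hδ.le]) (hsum.trans hsmall)
  have h1 : v (j + 1) = microPath Φ g h t₀ (x t₀) τ := by simp [hv]
  have h2 : w (j + 1) = x τ := by simp only [hw, hs_last]; congr 1; ring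
  rw [h1, h2] at key
  exact key.trans (mul_le_mul_of_nonneg_left hsum hΛ.le)

/-- A micro-solution computed with error `B` changes the macro-force by `O(B / η)`. -/
theorem norm_kernelForce_sub_kernelForce_le {p k : ℕ} {K : ℝ → ℝ} (hK : IsKernel p k K)
    (hk : 1 ≤ k) {A B : ℝ} (hη : 0 < η) (hA : ∀ t, |iteratedDeriv 1 K t| ≤ A) {v z : ℝ → E}
    (hv : IntervalIntegrable v volume t₀ (t₀ + η)) (hz : ContinuousOn z (Icc t₀ (t₀ + η)))
    (hB : ∀ τ ∈ Icc t₀ (t₀ + η), ‖v τ - z τ‖ ≤ B) :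
    ‖kernelForce K η t₀ v - kernelForce K η t₀ z‖ ≤ 4 * A * (B / η) := by
  have hle : t₀ ≤ t₀ + η := by linarith
  have hA0 : 0 ≤ A := (abs_nonneg _).trans (hA 0)
  have hWc := hK.continuous_windowWeight (η := η) (t₀ := t₀) hk
  have hz' : IntervalIntegrable z volume t₀ (t₀ + η) :=
    ContinuousOn.intervalIntegrable (by rwa [uIcc_of_le hle])
  simp only [kernelForce, hK.deriv_scaledKernel hk]
  have hcs : ∀ f : ℝ → E, IntervalIntegrable f volume t₀ (t₀ + η) →
      IntervalIntegrable (fun τ => -windowWeight K η t₀ 1 τ • f τ) volume t₀ (t₀ + η) :=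
    fun f hf => hf.continuousOn_smul hWc.neg.continuousOn
  rw [← intervalIntegral.integral_sub (hcs v hv) (hcs z hz')]
  refine (intervalIntegral.norm_integral_le_of_norm_le_const (C := A * (2 / η) ^ 2 * B)
    fun τ hτ => ?_).trans_eq ?_
  · rw [uIoc_of_le hle] at hτ
    rw [← smul_sub, norm_smul, norm_neg]
    exact mul_le_mul (abs_windowWeight_le hη hA τ) (hB τ (Ioc_subset_Icc_self hτ)) (norm_nonneg _)
      (by positivity)
  · rw [add_sub_cancel_left, abs_of_pos hη]; field_simp; ring
end

/-! ### The scalings -/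

section
variable {r k S : ℕ} {c₁ c₂ e H η h : ℝ}

theorem speedupRate_eq (k S : ℕ) (he : 0 < e) (hH : 0 < H) :
    speedupRate k S e H = H / e * (e * H ^ S) ^ (1 / (k : ℝ)) := by
  rw [speedupRate, Real.mul_rpow he.le (by positivity), ← Real.rpow_natCast H S,
    ← Real.rpow_mul hH.le, Real.rpow_sub he, Real.rpow_add hH, Real.rpow_one, Real.rpow_one,
    mul_one_div]
  ring

theorem complexityRate_eq (r k S : ℕ) (he : 0 < e) (hH : 0 < H) :
    complexityRate r k S e H =
      ((e * H ^ S) ^ (((r : ℝ) + k + 1) / (k * r)))⁻¹ / H := by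
  rw [complexityRate, ← Real.rpow_neg (by positivity), Real.mul_rpow he.le (by positivity),
    ← Real.rpow_natCast H S, ← Real.rpow_mul hH.le, Real.rpow_sub hH, Real.rpow_one,
    mul_comm (S : ℝ)]
  ring

theorem SatisfiesScaling.mul_le_div (hs : SatisfiesScaling r k S c₁ c₂ e H η h) (he : 0 < e)
    (hH : 0 < H) : c₁ * (e * H ^ S) ^ (1 / (k : ℝ)) ≤ e / η := by
  have h1 := hs.2.1
  rw [speedupRate_eq k S he hH, speedup] at h1
  have h2 := mul_le_mul_of_nonneg_left h1 (div_pos he hH).le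
  calc _ = e / H * (c₁ * (H / e * (e * H ^ S) ^ (1 / (k : ℝ)))) := by field_simp
    _ ≤ e / H * (H / η) := h2
    _ = e / η := by field_simp

theorem SatisfiesScaling.div_le_mul (hs : SatisfiesScaling r k S c₁ c₂ e H η h) (he : 0 < e)
    (hH : 0 < H) : e / η ≤ c₂ * (e * H ^ S) ^ (1 / (k : ℝ)) := by
  have h1 := hs.2.2
  rw [speedupRate_eq k S he hH, speedup] at h1
  have h2 := mul_le_mul_of_nonneg_left h1 (div_pos he hH).le
  calc e / η = e / H * (H / η) := by field_simp
    _ ≤ e / H * (c₂ * (H / e * (e * H ^ S) ^ (1 / (k : ℝ)))) := h2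
    _ = _ := by field_simp

/-- The residue `e^(k-1) / η^k` of the fast dynamics is `O(H^S)`. -/
theorem SatisfiesScaling.pow_div_pow_le (hs : SatisfiesScaling r k S c₁ c₂ e H η h) (hk : 1 ≤ k)
    (he : 0 < e) (hH : 0 < H) (hη : 0 < η) : e ^ (k - 1) / η ^ k ≤ c₂ ^ k * H ^ S := by
  have h1 := pow_le_pow_left₀ (div_nonneg he.le hη.le) (hs.div_le_mul he hH) k
  have hk0 : k ≠ 0 := by omega
  rw [mul_pow, ← Real.rpow_natCast (_ ^ (1 / (k : ℝ))) k, ← Real.rpow_mul (by positivity),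
    one_div_mul_cancel (by exact_mod_cast hk0), Real.rpow_one, div_pow] at h1
  have h2 : e ^ k = e * e ^ (k - 1) := by rw [← pow_succ', Nat.sub_add_cancel hk]
  rw [h2, mul_div_assoc] at h1
  exact le_of_mul_le_mul_left (h1.trans_eq (by ring)) he

/-- Powers of `e H^S` are bounded by powers of `H₀^S`, and small together with `e`. -/
theorem mul_pow_rpow_le {H₀ a : ℝ} (ha : 0 ≤ a) (he : 0 < e) (hH : 0 < H) (hH₀ : H ≤ H₀) :
    (e * H ^ S) ^ a ≤ (H₀ ^ S) ^ a * e ^ a := by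
  rw [← Real.mul_rpow (by have := hH.trans_le hH₀; positivity) he.le, mul_comm]
  refine Real.rpow_le_rpow (by positivity) ?_ ha
  gcongr

theorem SatisfiesScaling.step_le (hs : SatisfiesScaling r k S c₁ c₂ e H η h) (hr : 1 ≤ r)
    (hk : 1 ≤ k) (hc₁ : 0 < c₁) (he : 0 < e) (hH : 0 < H) (hη : 0 < η) (hh : 0 < h) :
    h / e ≤ c₁⁻¹ ^ 2 * (e * H ^ S) ^ (((k : ℝ) + 1) / (k * r)) := by
  have hr0 : (r : ℝ) ≠ 0 := by positivity
  have hk0 : (k : ℝ) ≠ 0 := by positivity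
  set q := e * H ^ S with hq
  have hq0 : 0 < q := by positivity
  have h1 := hs.1.1
  rw [complexityRate_eq r k S he hH, complexity] at h1
  have h2 := hs.mul_le_div he hH
  rw [← hq] at h1 h2
  have h3 : q ^ (((r : ℝ) + k + 1) / (k * r)) =
      q ^ (((k : ℝ) + 1) / (k * r)) * q ^ (1 / (k : ℝ)) := by
    rw [← Real.rpow_add hq0]; congr 1; field_simp; ring
  rw [h3] at h1
  have hX : 0 < q ^ (1 / (k : ℝ)) := by positivity
  have hY : 0 < q ^ (((k : ℝ) + 1) / (k * r)) := by positivity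
  generalize q ^ (1 / (k : ℝ)) = X at *
  generalize q ^ (((k : ℝ) + 1) / (k * r)) = Y at *
  have h4 : h ≤ c₁⁻¹ * η * (Y * X) := by
    have h5 : c₁ * ((Y * X)⁻¹ / H) * (H * h) * (Y * X) ≤ η / (H * h) * (H * h) * (Y * X) := by
      gcongr
    have h6 : c₁ * h ≤ η * (Y * X) := by
      calc c₁ * h = c₁ * ((Y * X)⁻¹ / H) * (H * h) * (Y * X) := by field_simp
        _ ≤ _ := h5
        _ = _ := by field_simp
    calc h = c₁⁻¹ * (c₁ * h) := by field_simp
      _ ≤ c₁⁻¹ * (η * (Y * X)) := by gcongr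
      _ = _ := by ring
  have h7 : η * X ≤ c₁⁻¹ * e := by
    have h8 : c₁⁻¹ * η * (c₁ * X) ≤ c₁⁻¹ * η * (e / η) := by gcongr
    calc η * X = c₁⁻¹ * η * (c₁ * X) := by field_simp
      _ ≤ _ := h8
      _ = _ := by field_simp
  rw [div_le_iff₀ he]
  calc h ≤ c₁⁻¹ * Y * (η * X) := h4.trans_eq (by ring)
    _ ≤ c₁⁻¹ * Y * (c₁⁻¹ * e) := by gcongr
    _ = _ := by ring

/-- The accumulated error of the micro-solver, relative to the window, is of higher order than
`H^S`. -/
theorem SatisfiesScaling.pow_step_div_le (hs : SatisfiesScaling r k S c₁ c₂ e H η h) (hr : 1 ≤ r)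
    (hk : 1 ≤ k) (hc₁ : 0 < c₁) (he : 0 < e) (hH : 0 < H) (hη : 0 < η) (hh : 0 < h) :
    h ^ r / e ^ (r + 1) ≤ c₁⁻¹ ^ (2 * r) * H ^ S * (e * H ^ S) ^ (1 / (k : ℝ)) := by
  have hr0 : (r : ℝ) ≠ 0 := by positivity
  have hk0 : (k : ℝ) ≠ 0 := by positivity
  have h1 := pow_le_pow_left₀ (by positivity) (hs.step_le hr hk hc₁ he hH hη hh) r
  have hq0 : 0 < e * H ^ S := by positivity
  rw [mul_pow, ← Real.rpow_natCast (_ ^ (((k : ℝ) + 1) / (k * r))) r, ← Real.rpow_mul hq0.le,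
    show ((k : ℝ) + 1) / (k * r) * r = 1 + 1 / k by field_simp, Real.rpow_add hq0, Real.rpow_one,
    div_pow, ← pow_mul] at h1
  rw [pow_succ, ← div_div, div_le_iff₀ he]
  refine h1.trans_eq (by ring)

theorem le_one_of_le_windowThreshold {q : ℕ} (hk : 1 ≤ k) (he : 0 < e) (he1 : e ≤ 1)
    (h : η ≤ windowThreshold q k e) : η ≤ 1 := by
  have hk1 : (1 : ℝ) ≤ k := by exact_mod_cast hk
  exact h.trans (Real.rpow_le_one he.le he1 (div_nonneg (by linarith) (by positivity)))

theorem pow_le_of_le_windowThreshold {q : ℕ} (hk : 1 ≤ k) (he : 0 < e) (hη : 0 < η)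
    (h : η ≤ windowThreshold q k e) : η ^ q ≤ e ^ (k - 1) / η ^ k := by
  rw [le_div_iff₀ (by positivity), ← pow_add, add_comm q k]
  have h1 := pow_le_pow_left₀ hη.le h (k + q)
  have hkq : ((k : ℝ) + q) ≠ 0 := by positivity
  rw [windowThreshold, ← Real.rpow_natCast (_ ^ _) (k + q), ← Real.rpow_mul he.le, Nat.cast_add,
    div_mul_cancel₀ _ hkq, ← Nat.cast_one, ← Nat.cast_sub hk, Real.rpow_natCast] at h1
  exact h1
end

theorem eventually_mul_rpow_le {a b : ℝ} (C : ℝ) (ha : 0 < a) (hb : 0 < b) :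
    ∀ᶠ e in 𝓝[>] (0 : ℝ), C * e ^ a ≤ b := by
  have h := (Real.continuousAt_rpow_const 0 a (Or.inr ha.le)).tendsto.const_mul C
  rw [Real.zero_rpow ha.ne', mul_zero] at h
  exact (h.mono_left nhdsWithin_le_nhds).eventually (eventually_le_nhds hb)

/-- The window length `e (e H^S)^(-1/k)` at which the speedup equals its rate falls below a
threshold whose exponent is smaller. -/
theorem eventually_window_le_windowThreshold {k S q : ℕ} (hk : 2 ≤ k) (hq : 1 ≤ q) {H : ℝ}
    (hH : 0 < H) :
    ∀ᶠ e in 𝓝[>] (0 : ℝ), H / speedupRate k S e H ≤ windowThreshold q k e := by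
  have hk2 : (2 : ℝ) ≤ k := by exact_mod_cast hk
  have hq1 : (1 : ℝ) ≤ q := by exact_mod_cast hq
  set a := 1 - 1 / (k : ℝ) - ((k : ℝ) - 1) / (k + q) with ha
  have ha0 : 0 < a := by
    have : a = ((k : ℝ) - 1) * q / (k * (k + q)) := by rw [ha]; field_simp; ring
    rw [this]
    exact div_pos (mul_pos (by linarith) (by linarith)) (by positivity)
  filter_upwards [eventually_mul_rpow_le ((H ^ S) ^ (1 / (k : ℝ)))⁻¹ ha0 one_pos,
    self_mem_nhdsWithin] with e h1 he
  rw [mem_Ioi] at he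
  have h2 : H / speedupRate k S e H = ((H ^ S) ^ (1 / (k : ℝ)))⁻¹ * e ^ a *
      windowThreshold q k e := by
    rw [windowThreshold, mul_assoc, ← Real.rpow_add he, ha, sub_add_cancel, speedupRate_eq k S he hH,
      Real.mul_rpow he.le (by positivity), Real.rpow_sub he, Real.rpow_one]
    field_simp
  rw [h2]
  exact mul_le_of_le_one_left (by unfold windowThreshold; positivity) h1

theorem exists_satisfiesScaling {r k p S : ℕ} (hr : 1 ≤ r) (hk : 1 ≤ k) (hp : 1 ≤ p)
    {c₁ c₂ : ℝ} (hc₁' : c₁ ≤ 1) (hc₂ : 1 < c₂) {H : ℝ} (hH : 0 < H) :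
    ∃ εH > 0, ∀ e : ℝ, 0 < e → e < εH →
      ∃ (N : ℕ) (η h : ℝ), 1 ≤ N ∧ 0 < h ∧ η = N * h ∧ SatisfiesScaling r k S c₁ c₂ e H η h ∧
        (2 ≤ k → η ≤ windowThreshold 1 k e ∧ η ≤ windowThreshold p k e ∧ e ≤ H ^ S) := by
  set a := ((r : ℝ) + k + 1) / (k * r) with ha
  have ha0 : 0 < a := by positivity
  suffices hev : ∀ᶠ e in 𝓝[>] (0 : ℝ),
      ∃ (N : ℕ) (η h : ℝ), 1 ≤ N ∧ 0 < h ∧ η = N * h ∧ SatisfiesScaling r k S c₁ c₂ e H η h ∧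
        (2 ≤ k → η ≤ windowThreshold 1 k e ∧ η ≤ windowThreshold p k e ∧ e ≤ H ^ S) by
    obtain ⟨εH, hεH, hsub⟩ := mem_nhdsGT_iff_exists_Ioo_subset.1 hev
    exact ⟨εH, hεH, fun e he he' => hsub ⟨he, he'⟩⟩
  have hwin : ∀ᶠ e in 𝓝[>] (0 : ℝ), 2 ≤ k → H / speedupRate k S e H ≤ windowThreshold 1 k e ∧
      H / speedupRate k S e H ≤ windowThreshold p k e ∧ e ≤ H ^ S := by
    by_cases hk2 : 2 ≤ k
    · filter_upwards [eventually_window_le_windowThreshold (S := S) hk2 le_rfl hH,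
        eventually_window_le_windowThreshold (S := S) hk2 hp hH,
        eventually_mul_rpow_le 1 one_pos (by positivity : 0 < H ^ S)] with e h1 h2 h3 _
      exact ⟨h1, h2, by simpa using h3⟩
    · exact Eventually.of_forall fun e h => absurd h hk2
  filter_upwards [hwin, self_mem_nhdsWithin, eventually_mul_rpow_le ((H ^ S) ^ a) ha0
    (by linarith : 0 < c₂ - 1)] with e hw he h1
  rw [mem_Ioi] at he
  have hq : 0 < (e * H ^ S) ^ a := by positivity
  rw [← Real.mul_rpow (by positivity) he.le, mul_comm (H ^ S)] at h1
  have hrate : 0 < speedupRate k S e H := by unfold speedupRate; positivity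
  set N := ⌈((e * H ^ S) ^ a)⁻¹⌉₊ with hN
  have hN1 : 1 ≤ N := Nat.one_le_ceil_iff.2 (by positivity)
  have hN0 : (0 : ℝ) < N := by exact_mod_cast hN1
  have hNl : ((e * H ^ S) ^ a)⁻¹ ≤ N := Nat.le_ceil _
  -- the rounding error is covered because `c₂ > 1` and the rate is large
  have hNu : (N : ℝ) ≤ c₂ * ((e * H ^ S) ^ a)⁻¹ := by
    have h2 := (Nat.ceil_lt_add_one (a := ((e * H ^ S) ^ a)⁻¹) (by positivity)).le
    have h3 : 1 ≤ (c₂ - 1) * ((e * H ^ S) ^ a)⁻¹ := by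
      rw [← div_eq_mul_inv, le_div_iff₀ hq]; linarith
    linarith
  have hη : 0 < H / speedupRate k S e H := by positivity
  refine ⟨N, H / speedupRate k S e H, H / speedupRate k S e H / N, hN1, by positivity,
    by field_simp, ⟨?_, ?_⟩, hw⟩
  · have hc : complexity H (H / speedupRate k S e H) (H / speedupRate k S e H / N) = N / H := by
      unfold complexity; field_simp
    rw [hc, complexityRate_eq r k S he hH, ← ha]
    constructor
    · rw [← mul_div_assoc]
      gcongr
      exact (mul_le_of_le_one_left (by positivity) hc₁').trans hNl
    · rw [← mul_div_assoc]
      gcongr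
  · have hc : speedup H (H / speedupRate k S e H) = speedupRate k S e H := by
      unfold speedup; field_simp
    rw [hc]
    constructor <;> nlinarith

/-! ### The kernel estimation error -/

theorem matNorm_pos {n₂ : ℕ} (hn₂ : 0 < n₂) (ε : FastMat n₂) : 0 < matNorm ε := by
  have : Nonempty (Fin n₂) := ⟨⟨0, hn₂⟩⟩
  have : Nontrivial (Vec n₂) := inferInstance
  exact ε.norm_pos

/-- Error of the macro-force in terms of the window, the micro-step and `e = ‖ε‖`, before any
scaling is imposed. -/
theorem exists_norm_macroForce_sub_le {n₁ n₂ nᵤ : ℕ} (hn₂ : 0 < n₂) {r k p J : ℕ}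
    (hk : 1 ≤ k) (hp : 1 ≤ p) {K : ℝ → ℝ} (hK : IsKernel p k K)
    (Q : MicroState n₁ n₂ ≃L[ℝ] Vec nᵤ) (R : Vec nᵤ ≃L[ℝ] MicroState n₁ n₂)
    (hRQ : ∀ x, R (Q x) = x) {Φ : OneStep (MicroState n₁ n₂)} (hΦ : HasOrder Φ r)
    {κ M δ Λ : ℝ} (hκ : 0 < κ) (hM : 0 < M) (hδ : 0 < δ) (hΛ : 0 < Λ) :
    ∃ C > 0, ∃ ρ > 0,
      ∀ (fI : ℝ → MicroState n₁ n₂ → Vec n₁) (fII : ℝ → MicroState n₁ n₂ → Vec n₂)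
        (𝓔 : Set (FastMat n₂)) (D : Set (ℝ × Vec nᵤ)) (T : ℝ)
        (x : FastMat n₂ → ℝ → Vec nᵤ → ℝ → MicroState n₁ n₂) (fbar : ℝ → Vec nᵤ → ℝ → Vec nᵤ),
        IsTwoScaleFamily r p k J κ M δ T Q R fI fII 𝓔 D x fbar →
        ∀ ε ∈ 𝓔, matNorm ε ≤ 1 → ∀ (η h : ℝ) (N : ℕ), 0 < h → 1 ≤ N → η = N * h → η < T → η ≤ 1 →
        h / matNorm ε ≤ ρ → h ^ r / matNorm ε ^ (r + 1) ≤ ρ →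
        ∀ (t₀ : ℝ) (u₀ : Vec nᵤ), (t₀, u₀) ∈ D →
        IsStableAlong Φ (stiffField fI fII ε) (x ε t₀ u₀) t₀ η h δ Λ →
        (∀ j < N, ContinuousOn
          (fun s => Φ (stiffField fI fII ε) s (t₀ + j * h)
            (microGrid Φ (stiffField fI fII ε) h t₀ (R u₀) j)) (Set.Icc 0 h)) →
        ‖macroForce Q R K Φ (stiffField fI fII ε) η h t₀ u₀ - fbar t₀ u₀ (t₀ + η / 2)‖ ≤
            C * (h ^ r / matNorm ε ^ (r + 1) + η ^ p + matNorm ε ^ (k - 1) / η ^ k + matNorm ε) ∧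
          ‖fbar t₀ u₀ (t₀ + η / 2) - fbar t₀ u₀ (t₀ + η)‖ ≤ C * η := by
  obtain ⟨A, hA0, hA⟩ := hK.exists_bound
  obtain ⟨C₁, hC₁, hker⟩ := hK.exists_norm_kernelForce_sub_le (J := J) hk hp hM (U := Vec nᵤ)
  obtain ⟨C₀, hC₀, ρ₀, hρ₀, hord⟩ := hΦ δ hδ
  -- all derivatives of the vector field are bounded by `L₀ / e`
  set L₀ := 1 + M + M * κ with hL₀
  have hL₀0 : 0 < L₀ := by positivity
  set C₂ := 4 * A * (‖(Q : MicroState n₁ n₂ →L[ℝ] Vec nᵤ)‖ * (Λ * (C₀ * L₀ ^ (r + 1)))) with hC₂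
  have hC₂0 : 0 ≤ C₂ := by positivity
  refine ⟨C₂ + C₁ + M, by positivity, min (ρ₀ / L₀) (δ / (C₀ * L₀ ^ (r + 1))),
    by positivity, ?_⟩
  intro fI fII 𝓔 D T x fbar hF ε hε he1 η h N hh hN hηN hηT hη1 hstep hstep' t₀ u₀ hD hstab hcont
  set e := matNorm ε with he_def
  have he : 0 < e := matNorm_pos hn₂ ε
  have hη : 0 < η := by
    rw [hηN]; have : (0 : ℝ) < N := by exact_mod_cast hN
    positivity
  have hle : t₀ ≤ t₀ + η := by linarith
  set g := stiffField fI fII ε with hg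
  set y := x ε t₀ u₀ with hy
  have hsubT : Icc t₀ (t₀ + η) ⊆ Icc t₀ (t₀ + T) := Icc_subset_Icc_right (by linarith)
  have hgC : ContDiff ℝ r (Function.uncurry g) := contDiff_stiffField hF.smoothI hF.smoothII ε
  have hsol : SolvesOn g y t₀ (t₀ + η) := fun t ht =>
    (hF.solves ε hε t₀ u₀ hD t (hsubT ht)).mono hsubT
  have hyc : ContinuousOn y (Icc t₀ (t₀ + η)) := fun t ht => (hsol t ht).continuousWithinAt
  have hy0 : y t₀ = R u₀ := hF.initial ε hε t₀ u₀ hD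
  have hL1 : 1 ≤ L₀ / e := by
    rw [le_div_iff₀ he]
    have : 0 < M * κ := by positivity
    linarith
  have hbd : ∀ τ ∈ Icc t₀ (t₀ + η), ∀ z ∈ Metric.closedBall (y τ) δ, ∀ j ≤ r,
      ‖iteratedFDeriv ℝ j (Function.uncurry g) (τ, z)‖ ≤ L₀ / e := by
    intro τ hτ z hz j hj
    obtain ⟨h1, h2⟩ := hF.bounded ε hε t₀ u₀ hD τ (hsubT hτ) z hz j hj
    refine norm_iteratedFDeriv_stiffField_le hF.smoothI hF.smoothII ε hj h1 h2 ?_ ?_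
    · rw [le_div_iff₀ he]
      have : M * e ≤ M * 1 := by gcongr
      have : 0 < M * κ := by positivity
      linarith
    · calc matNorm ε.symm * M ≤ κ / e * M := by gcongr; exact hF.condition ε hε
        _ = M * κ / e := by ring
        _ ≤ _ := by gcongr; linarith
  have hmicro : ∀ τ ∈ Icc t₀ (t₀ + η), ‖microPath Φ g h t₀ (R u₀) τ - y τ‖ ≤
      Λ * (C₀ * η * (h ^ r * (L₀ / e) ^ (r + 1))) := by
    intro τ hτ
    rw [← hy0]
    refine norm_microPath_sub_le hC₀ hL1 hh (fun t s z => hord _ hL1 g hgC t s z) hsol hbd hstab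
      hδ hΛ (ρ := ρ₀) ?_ ?_ hτ
    · have h1 := hstep.trans (min_le_left _ _)
      rw [le_div_iff₀ hL₀0] at h1
      exact h1.trans_eq' (by ring)
    · have h1 := hstep'.trans (min_le_right _ _)
      rw [le_div_iff₀ (by positivity)] at h1
      calc C₀ * η * (h ^ r * (L₀ / e) ^ (r + 1)) =
            η * (h ^ r / e ^ (r + 1) * (C₀ * L₀ ^ (r + 1))) := by rw [div_pow]; ring
        _ ≤ 1 * (h ^ r / e ^ (r + 1) * (C₀ * L₀ ^ (r + 1))) := by gcongr
        _ ≤ δ := by rwa [one_mul]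
  set w : ℝ → Vec nᵤ := fun τ => transformedField Q R g τ (Q (y τ)) with hw
  have hweq : ∀ τ, w τ = Q (g τ (y τ)) := fun τ => by simp only [hw, transformedField, hRQ]
  have hzsol : SolvesOn (fun t _ => w t) (fun τ => Q (y τ)) t₀ (t₀ + η) := by
    intro t ht
    have := (Q : MicroState n₁ n₂ →L[ℝ] Vec nᵤ).hasFDerivAt.comp_hasDerivWithinAt t (hsol t ht)
    simp only [hweq]
    exact this
  have hwc : ContinuousOn w (Icc t₀ (t₀ + η)) := by
    have h1 : ContinuousOn (fun τ => Q (Function.uncurry g (τ, y τ))) (Icc t₀ (t₀ + η)) :=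
      Q.continuous.comp_continuousOn
        (hgC.continuous.comp_continuousOn (continuousOn_id.prodMk hyc))
    exact h1.congr fun τ _ => hweq τ
  have hfbM := hF.boundedForce t₀ u₀ hD
  have hexact := hker e η t₀ T (fun τ => Q (y τ)) w (fbar t₀ u₀) he hη hη1 hηT
    (hF.splitting ε hε t₀ u₀ hD) (hF.smoothForce t₀ u₀ hD) (fun t ht => hfbM t ht p le_rfl)
    hzsol hwc
  have hmp : IntervalIntegrable (fun τ => Q (microPath Φ g h t₀ (R u₀) τ)) volume t₀ (t₀ + η) := by
    have h1 := intervalIntegrable_microPath hh hcont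
    rw [← hηN] at h1
    constructor
    · exact (Q : MicroState n₁ n₂ →L[ℝ] Vec nᵤ).integrable_comp h1.1
    · exact (Q : MicroState n₁ n₂ →L[ℝ] Vec nᵤ).integrable_comp h1.2
  have hdiff := norm_kernelForce_sub_kernelForce_le hK hk hη (hA 1 hk) hmp
    (Q.continuous.comp_continuousOn hyc)
    (B := ‖(Q : MicroState n₁ n₂ →L[ℝ] Vec nᵤ)‖ * (Λ * (C₀ * η * (h ^ r * (L₀ / e) ^ (r + 1)))))
    (fun τ hτ => by
      simp only [Function.comp, ← map_sub]
      exact ((Q : MicroState n₁ n₂ →L[ℝ] Vec nᵤ).le_opNorm _).trans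
        (mul_le_mul_of_nonneg_left (hmicro τ hτ) (norm_nonneg _)))
  have hB : 4 * A * (‖(Q : MicroState n₁ n₂ →L[ℝ] Vec nᵤ)‖ *
      (Λ * (C₀ * η * (h ^ r * (L₀ / e) ^ (r + 1)))) / η) = C₂ * (h ^ r / e ^ (r + 1)) := by
    rw [hC₂, div_pow]; field_simp
  rw [hB] at hdiff
  constructor
  · have htri := norm_sub_le_norm_sub_add_norm_sub (macroForce Q R K Φ g η h t₀ u₀)
      (kernelForce K η t₀ fun τ => Q (y τ)) (fbar t₀ u₀ (t₀ + η / 2))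
    refine htri.trans ((add_le_add hdiff hexact).trans ?_)
    have h1 : 0 ≤ h ^ r / e ^ (r + 1) := by positivity
    have h2 : 0 ≤ η ^ p + e ^ (k - 1) / η ^ k + e := by positivity
    have h3 : C₂ * (h ^ r / e ^ (r + 1)) ≤ (C₂ + C₁ + M) * (h ^ r / e ^ (r + 1)) := by
      gcongr; linarith
    have h4 : C₁ * (η ^ p + e ^ (k - 1) / η ^ k + e) ≤
        (C₂ + C₁ + M) * (η ^ p + e ^ (k - 1) / η ^ k + e) := by
      gcongr; linarith
    linarith
  · have h1 := norm_sub_taylor_le (a := t₀) (b := t₀ + η) 1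
      ((hF.smoothForce t₀ u₀ hD).of_le (by exact_mod_cast hp))
      (fun t ht => hfbM t (hsubT ht) 1 hp) (t₀ + η) ⟨hle, le_rfl⟩ (t₀ + η / 2)
      ⟨by linarith, by linarith⟩
    simp only [Finset.sum_range_one, pow_zero, Nat.factorial_zero, Nat.cast_one, div_one, one_smul,
      iteratedDeriv_zero, pow_one] at h1
    refine h1.trans ?_
    rw [abs_of_nonpos (by linarith)]
    calc M * -(t₀ + η / 2 - (t₀ + η)) ≤ M * η := by gcongr; linarith
      _ ≤ _ := by gcongr; linarith

theorem theorem1 {n₁ n₂ nᵤ m : ℕ} (hn₂ : 0 < n₂) (r k p S J : ℕ)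
    (hr : 1 ≤ r) (hk : 1 ≤ k) (hp : 1 ≤ p) (hS : 1 ≤ S)
    (K : ℝ → ℝ) (hK : IsKernel p k K)
    (Q : MicroState n₁ n₂ ≃L[ℝ] Vec nᵤ) (R : Vec nᵤ ≃L[ℝ] MicroState n₁ n₂)
    (hRQ : ∀ x, R (Q x) = x)
    (Φ : OneStep (MicroState n₁ n₂)) (hΦ : HasOrder Φ r)
    (Ψ : MacroStep (Vec nᵤ) m) (hΨ : HasMacroOrder Ψ S)
    (κ M δ Λ H₀ c₁ c₂ : ℝ) (hκ : 0 < κ) (hM : 0 < M) (hδ : 0 < δ) (hΛ : 0 < Λ)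
    (hH₀ : 0 < H₀) (hc₁ : 0 < c₁) (hc₁' : c₁ ≤ 1) (hc₂ : 1 < c₂) :
    -- the scalings can be realized, with a whole number of micro-steps in each window,
    -- and for `k ≥ 2` in the regimes in which the error is controlled below
    (∀ H : ℝ, 0 < H → ∃ εH > 0, ∀ e : ℝ, 0 < e → e < εH →
      ∃ (N : ℕ) (η h : ℝ), 1 ≤ N ∧ 0 < h ∧ η = N * h ∧ SatisfiesScaling r k S c₁ c₂ e H η h ∧
        (2 ≤ k → η ≤ windowThreshold 1 k e ∧ η ≤ windowThreshold p k e ∧ e ≤ H ^ S)) ∧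
    -- under the scalings the kernel estimation error is at most `C_K H^S`
    (∃ C_K > 0, ∃ ε₀ > 0,
      ∀ (fI : ℝ → MicroState n₁ n₂ → Vec n₁) (fII : ℝ → MicroState n₁ n₂ → Vec n₂)
        (𝓔 : Set (FastMat n₂)) (D : Set (ℝ × Vec nᵤ)) (T : ℝ)
        (x : FastMat n₂ → ℝ → Vec nᵤ → ℝ → MicroState n₁ n₂)
        (fbar : ℝ → Vec nᵤ → ℝ → Vec nᵤ),
        IsTwoScaleFamily r p k J κ M δ T Q R fI fII 𝓔 D x fbar →
        ∀ ε ∈ 𝓔, matNorm ε ≤ ε₀ →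
        ∀ (H η h : ℝ) (N : ℕ), 0 < H → H ≤ H₀ → 0 < h → 1 ≤ N → η = N * h → η < T →
        SatisfiesScaling r k S c₁ c₂ (matNorm ε) H η h →
        ∀ (tInit : ℝ) (u F : ℕ → Vec nᵤ),
        IsHMMRun Q R K Φ Ψ (stiffField fI fII ε) H η h tInit u F →
        ∀ (n : ℕ) (tn : ℝ), tn = tInit + n * H → (tn, u n) ∈ D →
        IsStableAlong Φ (stiffField fI fII ε) (x ε tn (u n)) tn η h δ Λ →
        (∀ j < N, ContinuousOn
          (fun s => Φ (stiffField fI fII ε) s (tn + j * h)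
            (microGrid Φ (stiffField fI fII ε) h tn (R (u n)) j)) (Set.Icc 0 h)) →
        (η ≤ windowThreshold 1 k (matNorm ε) →
          ‖F n - fbar tn (u n) (tn + η)‖ ≤ C_K * H ^ S) ∧
        (η ≤ windowThreshold p k (matNorm ε) → matNorm ε ≤ H ^ S →
          ‖F n - fbar tn (u n) (tn + η / 2)‖ ≤ C_K * H ^ S)) := by
  refine ⟨fun H hH => exists_satisfiesScaling hr hk hp hc₁' hc₂ hH, ?_⟩
  obtain ⟨C, hC, ρ, hρ, hmain⟩ := exists_norm_macroForce_sub_le (J := J) hn₂ hk hp hK Q R hRQ hΦ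
    hκ hM hδ hΛ
  have ha : 0 < ((k : ℝ) + 1) / (k * r) := by positivity
  have hb : 0 < 1 / (k : ℝ) := by positivity
  obtain ⟨ε₀, hε₀, hsub⟩ := mem_nhdsGT_iff_exists_Ioo_subset.1
    (((eventually_mul_rpow_le (c₁⁻¹ ^ 2 * (H₀ ^ S) ^ (((k : ℝ) + 1) / (k * r))) ha hρ).and
      (eventually_mul_rpow_le (c₁⁻¹ ^ (2 * r) * H₀ ^ S * (H₀ ^ S) ^ (1 / (k : ℝ))) hb hρ)).and
      (eventually_mul_rpow_le 1 one_pos one_pos))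
  rw [mem_Ioi] at hε₀
  set X := (H₀ ^ S) ^ (1 / (k : ℝ)) with hX
  have hX0 : 0 < X := by positivity
  have hc₂0 : 0 < c₂ := by linarith
  set B := c₁⁻¹ ^ (2 * r) * X with hB
  refine ⟨C * (B + 3 * c₂ ^ k + c₂ * X * c₂ ^ k + 1), by positivity, ε₀ / 2, by positivity, ?_⟩
  intro fI fII 𝓔 D T x fbar hF ε hε hεle H η h N hH hHH₀ hh hN hηN hηT hsc tInit u F hrun n tn htn
    hD hstab hcont
  set e := matNorm ε with he_def
  have he : 0 < e := matNorm_pos hn₂ ε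
  obtain ⟨⟨hs1, hs2⟩, hs3⟩ := hsub (show e ∈ Ioo 0 ε₀ from ⟨he, by linarith⟩)
  have he1 : e ≤ 1 := by simpa using hs3
  have hη : 0 < η := by
    rw [hηN]; have : (0 : ℝ) < N := by exact_mod_cast hN
    positivity
  have hq1 := mul_pow_rpow_le (S := S) ha.le he hH hHH₀
  have hq2 := mul_pow_rpow_le (S := S) hb.le he hH hHH₀
  have hq3 : (e * H ^ S) ^ (1 / (k : ℝ)) ≤ X :=
    hq2.trans (mul_le_of_le_one_right hX0.le (Real.rpow_le_one he.le he1 hb.le))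
  have hstep : h / e ≤ ρ := by
    refine (hsc.step_le hr hk hc₁ he hH hη hh).trans (le_trans ?_ hs1)
    rw [mul_assoc]
    gcongr
  have hpow := hsc.pow_step_div_le hr hk hc₁ he hH hη hh
  have hstep' : h ^ r / e ^ (r + 1) ≤ ρ := by
    refine hpow.trans (le_trans ?_ hs2)
    rw [mul_assoc _ X]
    gcongr
  have hmic : h ^ r / e ^ (r + 1) ≤ B * H ^ S := by
    calc _ ≤ c₁⁻¹ ^ (2 * r) * H ^ S * (e * H ^ S) ^ (1 / (k : ℝ)) := hpow
      _ ≤ c₁⁻¹ ^ (2 * r) * H ^ S * X := by gcongr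
      _ = B * H ^ S := by rw [hB]; ring
  have hres := hsc.pow_div_pow_le hk he hH hη
  have hFn : F n = macroForce Q R K Φ (stiffField fI fII ε) η h tn (u n) := by
    rw [hrun.microProcess n, htn]
  have hest : η ≤ 1 → _ := fun hη1 => hmain fI fII 𝓔 D T x fbar hF ε hε he1 η h N hh hN hηN hηT hη1
    hstep hstep' tn (u n) hD hstab hcont
  rw [hFn]
  have hHS : 0 < H ^ S := by positivity
  have hcX : 0 ≤ c₂ * X * (c₂ ^ k * H ^ S) := by positivity
  have hck : 0 < c₂ ^ k * H ^ S := by positivity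
  constructor
  · intro hth
    have hη1 := le_one_of_le_windowThreshold hk he he1 hth
    obtain ⟨h1, h2⟩ := hest hη1
    have hηle : η ≤ c₂ ^ k * H ^ S := by
      simpa using (pow_le_of_le_windowThreshold hk he hη hth).trans hres
    have hηp : η ^ p ≤ c₂ ^ k * H ^ S :=
      (pow_le_of_le_one hη.le hη1 (by omega)).trans hηle
    -- the remainder of order `e` is absorbed because `e` is at most of the order of the window
    have hele : e ≤ c₂ * X * (c₂ ^ k * H ^ S) := by
      have h3 := (hsc.div_le_mul he hH).trans (mul_le_mul_of_nonneg_left hq3 hc₂0.le)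
      rw [div_le_iff₀ hη] at h3
      exact h3.trans (by gcongr)
    refine (norm_sub_le_norm_sub_add_norm_sub _ (fbar tn (u n) (tn + η / 2)) _).trans
      ((add_le_add h1 h2).trans ?_)
    rw [← mul_add, mul_assoc C]
    refine mul_le_mul_of_nonneg_left ?_ hC.le
    linarith
  · intro hth heH
    have hη1 := le_one_of_le_windowThreshold hk he he1 hth
    have hηp : η ^ p ≤ c₂ ^ k * H ^ S := (pow_le_of_le_windowThreshold hk he hη hth).trans hres
    refine (hest hη1).1.trans ?_
    rw [mul_assoc C]
    refine mul_le_mul_of_nonneg_left ?_ hC.le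
    linarith
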